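/- Let $\hat{\mathcal P}_2=\{\sigma_1\otimes\sigma_2 : \sigma_1,\sigma_2\in\{I,X,Y,Z\}\}\subset U(4)$ be the set of two-qubit Pauli matrices, where $X=\begin{pmatrix}0&1\\1&0\end{pmatrix}$, $Y=\begin{pmatrix}0&-i\\i&0\end{pmatrix}$, $Z=\begin{pmatrix}1&0\\0&-1\end{pmatrix}$, and let $\langle\hat{\mathcal P}_2\rangle$ be the subgroup of $U(4)$ that it generates. The two-qubit Clifford group $\mathcal C_2$ is the normalizer of $\langle\hat{\mathcal P}_2\rangle$ in $U(4)$ modulo the scalar matrices (global phases), and the two-qubit Pauli group $\mathcal P_2\le\mathcal C_2$ is the image of $\langle\hat{\mathcal P}_2\rangle$. Let $H=\frac1{\sqrt2}\begin{pmatrix}1&1\\1&-1\end{pmatrix}$ and $P=\begin{pmatrix}1&0\\0&i\end{pmatrix}$, let $H_1,H_2,P_1,P_2\in\mathcal C_2$ be the classes of $H\otimes I$, $I\otimes H$, $P\otimes I$, $I\otimes P$, and let $CZ\in\mathcal C_2$ be the class of the controlled-$Z$ gate $\begin{pmatrix}1&0\\0&0\end{pmatrix}\otimes I+\begin{pmatrix}0&0\\0&1\end{pmatrix}\otimes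 Z$. Then $|\mathcal C_2|=11520$, and: 1. The proper nontrivial normal subgroups of $\mathcal C_2$ are exactly the following two: the Pauli group $\mathcal P_2$, which has order $16$, and the commutator subgroup $[\mathcal C_2,\mathcal C_2]$, which has order $5760$. 2. $\mathcal C_2$ has exactly $21$ conjugacy classes and exactly $21$ irreducible complex characters. 3. There is a homomorphism $\mathrm{sgn}:\mathcal C_2\to\{\pm1\}$ with $\mathrm{sgn}(H_1)=\mathrm{sgn}(H_2)=\mathrm{sgn}(P_1)=\mathrm{sgn}(P_2)=\mathrm{sgn}(CZ)=-1$, and the only homomorphisms $\mathcal C_2\to\mathbb C^\times$ are the trivial one and $\mathrm{sgn}$. Equivalently, on every one-dimensional complex representation of $\mathcal C_2$ the group acts either trivially or through $\mathrm{sgn}$. -/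

import Mathlib

open scoped Matrix Kronecker

noncomputable section

namespace TwoQubit

/-- The single-qubit unitary group `U(2)`. -/
abbrev U2 : Type := Matrix.unitaryGroup (Fin 2) ℂ

/-- The two-qubit unitary group `U(4)`, acting on `ℂ² ⊗ ℂ²` with basis indexed by pairs. -/
abbrev U4 : Type := Matrix.unitaryGroup (Fin 2 × Fin 2) ℂ

/-- The tensor (Kronecker) product of two single-qubit unitaries. -/
def tensor (A B : U2) : U4 :=
  ⟨(A : Matrix (Fin 2) (Fin 2) ℂ) ⊗ₖ (B : Matrix (Fin 2) (Fin 2) ℂ),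
    Matrix.kronecker_mem_unitary A.2 B.2⟩

theorem tensor_mul (A B C D : U2) : tensor A B * tensor C D = tensor (A * C) (B * D) :=
  Subtype.ext (Matrix.mul_kronecker_mul _ _ _ _).symm

theorem tensor_one : tensor 1 1 = 1 := Subtype.ext Matrix.one_kronecker_one

/-! ### Pauli matrices and the single-qubit gates -/

/-- The Pauli matrix `X`. -/
def pauliX : U2 := ⟨!![0, 1; 1, 0], by
  rw [Matrix.mem_unitaryGroup_iff]
  ext i j; fin_cases i <;> fin_cases j <;> simp [Matrix.mul_apply, Matrix.star_apply]⟩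

/-- The Pauli matrix `Y`. -/
def pauliY : U2 := ⟨!![0, -Complex.I; Complex.I, 0], by
  rw [Matrix.mem_unitaryGroup_iff]
  ext i j; fin_cases i <;> fin_cases j <;> simp [Matrix.mul_apply, Matrix.star_apply]⟩

/-- The Pauli matrix `Z`. -/
def pauliZ : U2 := ⟨!![1, 0; 0, -1], by
  rw [Matrix.mem_unitaryGroup_iff]
  ext i j; fin_cases i <;> fin_cases j <;> simp [Matrix.mul_apply, Matrix.star_apply]⟩

theorem sqrt_two_inv_mul_self : ((√2 : ℝ) : ℂ)⁻¹ * ((√2 : ℝ) : ℂ)⁻¹ = 1 / 2 := by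
  rw [← mul_inv, ← Complex.ofReal_mul, Real.mul_self_sqrt (by norm_num)]
  norm_num

/-- The Hadamard gate. -/
def hadamard : U2 := ⟨((√2 : ℝ) : ℂ)⁻¹ • !![1, 1; 1, -1], by
  rw [Matrix.mem_unitaryGroup_iff]
  have h := sqrt_two_inv_mul_self
  ext i j; fin_cases i <;> fin_cases j <;>
    simp [Matrix.mul_apply, Matrix.star_apply, h] <;> norm_num⟩

/-- The phase gate. -/
def phase : U2 := ⟨!![1, 0; 0, Complex.I], by
  rw [Matrix.mem_unitaryGroup_iff]
  ext i j; fin_cases i <;> fin_cases j <;> simp [Matrix.mul_apply, Matrix.star_apply]⟩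

/-- The controlled-`Z` gate `|0⟩⟨0| ⊗ I + |1⟩⟨1| ⊗ Z`. -/
def controlledZ : U4 :=
  ⟨!![1, 0; 0, 0] ⊗ₖ (1 : Matrix (Fin 2) (Fin 2) ℂ) + !![0, 0; 0, 1] ⊗ₖ !![1, 0; 0, -1], by
    rw [Matrix.mem_unitaryGroup_iff]
    ext ⟨i, i'⟩ ⟨j, j'⟩
    fin_cases i <;> fin_cases i' <;> fin_cases j <;> fin_cases j' <;>
      simp [Matrix.mul_apply, Matrix.star_apply, Fintype.sum_prod_type, Matrix.one_apply]⟩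

/-! ### The Pauli group and the Clifford group -/

/-- The single-qubit Pauli matrices `I, X, Y, Z`. -/
def pauliMatrices : Set U2 := {1, pauliX, pauliY, pauliZ}

/-- The sixteen two-qubit Pauli matrices `σ₁ ⊗ σ₂`. -/
def pauliStrings : Set U4 := {U | ∃ s ∈ pauliMatrices, ∃ t ∈ pauliMatrices, U = tensor s t}

/-- The subgroup of `U(4)` generated by the two-qubit Pauli matrices (phases included). -/
def phasedPauli : Subgroup U4 := Subgroup.closure pauliStrings

/-- The normalizer in `U(4)` of the group generated by the Pauli matrices (phases included). -/
def phasedClifford : Subgroup U4 := Subgroup.normalizer (phasedPauli : Set U4)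

/-- The global phases: all scalar matrices in `U(4)`. -/
def globalPhases : Subgroup U4 where
  carrier := {U | ∃ c : ℂ, (U : Matrix (Fin 2 × Fin 2) (Fin 2 × Fin 2) ℂ) = c • 1}
  one_mem' := ⟨1, by simp⟩
  mul_mem' := by
    rintro U V ⟨c, hc⟩ ⟨d, hd⟩
    exact ⟨c * d, by simp [hc, hd, smul_smul, mul_comm]⟩
  inv_mem' := by
    rintro U ⟨c, hc⟩
    refine ⟨star c, ?_⟩
    change star (U : Matrix (Fin 2 × Fin 2) (Fin 2 × Fin 2) ℂ) = _
    rw [hc, star_smul, star_one]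

instance globalPhases_normal : globalPhases.Normal where
  conj_mem := by
    rintro U ⟨c, hc⟩ V
    refine ⟨c, ?_⟩
    have hV : (V : Matrix (Fin 2 × Fin 2) (Fin 2 × Fin 2) ℂ) * ((V⁻¹ : U4) : Matrix _ _ ℂ) = 1 :=
      congrArg Subtype.val (mul_inv_cancel V)
    change (V : Matrix (Fin 2 × Fin 2) (Fin 2 × Fin 2) ℂ) * (U : Matrix _ _ ℂ)
      * ((V⁻¹ : U4) : Matrix _ _ ℂ) = _
    rw [hc, Matrix.mul_smul, Matrix.smul_mul, mul_one, hV]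

/-- The two-qubit Clifford group: the normalizer of the Pauli group in `U(4)`, modulo global
phases. -/
abbrev CliffordGroup : Type := phasedClifford ⧸ globalPhases.subgroupOf phasedClifford

/-- The class in the Clifford group of a unitary that normalizes the Pauli group. -/
def toClifford : phasedClifford →* CliffordGroup :=
  QuotientGroup.mk' (globalPhases.subgroupOf phasedClifford)

/-- The two-qubit Pauli group modulo phases, as a subgroup of the Clifford group. -/
def pauliGroup : Subgroup CliffordGroup :=
  (phasedPauli.subgroupOf phasedClifford).map toClifford

/-! ### The generating gates belong to the Clifford group -/

theorem mem_normalizer_closure_of_pow {G : Type*} [Group G] {S : Set G} {A : G} (n : ℕ)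
    (hA : A ^ (n + 1) = 1) (h : ∀ s ∈ S, A * s * A⁻¹ ∈ Subgroup.closure S) :
    A ∈ Subgroup.normalizer (Subgroup.closure S : Set G) := by
  have h1 : ∀ x ∈ Subgroup.closure S, A * x * A⁻¹ ∈ Subgroup.closure S := by
    have : Subgroup.closure S ≤ (Subgroup.closure S).comap (MulAut.conj A).toMonoidHom := by
      rw [Subgroup.closure_le]
      exact fun s hs => h s hs
    exact fun x hx => this hx
  have h2 : ∀ k : ℕ, ∀ x ∈ Subgroup.closure S, A ^ k * x * (A ^ k)⁻¹ ∈ Subgroup.closure S := by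
    intro k
    induction k with
    | zero => intro x hx; simpa using hx
    | succ k ih =>
      intro x hx
      have := h1 _ (ih x hx)
      rw [pow_succ']
      simpa [mul_assoc] using this
  have h3 : A ^ n = A⁻¹ := by
    rw [eq_inv_iff_mul_eq_one, ← pow_succ, hA]
  rw [Subgroup.mem_normalizer_iff]
  intro x
  refine ⟨h1 x, fun hx => ?_⟩
  have := h2 n _ hx
  rw [h3] at this
  simpa [mul_assoc] using this

theorem pauliX_mem : pauliX ∈ pauliMatrices := by simp [pauliMatrices]
theorem pauliY_mem : pauliY ∈ pauliMatrices := by simp [pauliMatrices]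
theorem pauliZ_mem : pauliZ ∈ pauliMatrices := by simp [pauliMatrices]
theorem one_mem_pauliMatrices : (1 : U2) ∈ pauliMatrices := by simp [pauliMatrices]

theorem tensor_mem {s t : U2} (hs : s ∈ Subgroup.closure pauliMatrices)
    (ht : t ∈ Subgroup.closure pauliMatrices) : tensor s t ∈ phasedPauli := by
  let f : U2 →* U4 := ⟨⟨fun A => tensor A 1, tensor_one⟩, fun A B => by simp [tensor_mul]⟩
  let g : U2 →* U4 := ⟨⟨fun A => tensor 1 A, tensor_one⟩, fun A B => by simp [tensor_mul]⟩
  have hf : Subgroup.closure pauliMatrices ≤ phasedPauli.comap f := by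
    rw [Subgroup.closure_le]
    exact fun A hA => Subgroup.subset_closure ⟨A, hA, 1, one_mem_pauliMatrices, rfl⟩
  have hg : Subgroup.closure pauliMatrices ≤ phasedPauli.comap g := by
    rw [Subgroup.closure_le]
    exact fun A hA => Subgroup.subset_closure ⟨1, one_mem_pauliMatrices, A, hA, rfl⟩
  have h : f s * g t ∈ phasedPauli := mul_mem (hf hs) (hg ht)
  have e : f s * g t = tensor s t := by
    change tensor s 1 * tensor 1 t = _
    rw [tensor_mul, mul_one, one_mul]
  rwa [e] at h

theorem hadamard_sq : hadamard * hadamard = 1 := by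
  have h := sqrt_two_inv_mul_self
  ext i j; fin_cases i <;> fin_cases j <;>
    simp [hadamard, h] <;> norm_num

theorem phase_pow : phase ^ 4 = 1 := by
  apply Subtype.ext
  rw [SubmonoidClass.coe_pow]
  ext i j; fin_cases i <;> fin_cases j <;>
    simp [phase, pow_succ, Matrix.mul_apply]

theorem hadamard_conj {s : U2} (hs : s ∈ pauliMatrices) :
    hadamard * s * hadamard⁻¹ ∈ Subgroup.closure pauliMatrices := by
  have hx := Subgroup.subset_closure pauliX_mem
  have hy := Subgroup.subset_closure pauliY_mem
  have hz := Subgroup.subset_closure pauliZ_mem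
  have e1 : hadamard * pauliX = pauliZ * hadamard := by
    ext i j; fin_cases i <;> fin_cases j <;>
      simp [hadamard, pauliX, pauliZ]
  have e2 : hadamard * pauliY = pauliX * pauliY * pauliX * hadamard := by
    ext i j; fin_cases i <;> fin_cases j <;>
      simp [hadamard, pauliX, pauliY, mul_comm]
  have e3 : hadamard * pauliZ = pauliX * hadamard := by
    ext i j; fin_cases i <;> fin_cases j <;>
      simp [hadamard, pauliX, pauliZ]
  rcases hs with rfl | rfl | rfl | rfl
  · simp
  · rw [e1, mul_inv_cancel_right]; exact hz
  · rw [e2, mul_inv_cancel_right]; exact mul_mem (mul_mem hx hy) hx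
  · rw [e3, mul_inv_cancel_right]; exact hx

theorem phase_conj {s : U2} (hs : s ∈ pauliMatrices) :
    phase * s * phase⁻¹ ∈ Subgroup.closure pauliMatrices := by
  have hx := Subgroup.subset_closure pauliX_mem
  have hy := Subgroup.subset_closure pauliY_mem
  have hz := Subgroup.subset_closure pauliZ_mem
  have e1 : phase * pauliX = pauliY * phase := by
    ext i j; fin_cases i <;> fin_cases j <;>
      simp [phase, pauliX, pauliY]
  have e2 : phase * pauliY = pauliY * pauliX * pauliY * phase := by
    ext i j; fin_cases i <;> fin_cases j <;>
      simp [phase, pauliX, pauliY]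
  have e3 : phase * pauliZ = pauliZ * phase := by
    ext i j; fin_cases i <;> fin_cases j <;>
      simp [phase, pauliZ]
  rcases hs with rfl | rfl | rfl | rfl
  · simp
  · rw [e1, mul_inv_cancel_right]; exact hy
  · rw [e2, mul_inv_cancel_right]; exact mul_mem (mul_mem hy hx) hy
  · rw [e3, mul_inv_cancel_right]; exact hz

theorem tensor_inv (A B : U2) : (tensor A B)⁻¹ = tensor A⁻¹ B⁻¹ := by
  rw [inv_eq_iff_mul_eq_one, tensor_mul, mul_inv_cancel, mul_inv_cancel, tensor_one]

theorem tensor_pow (A B : U2) (n : ℕ) : tensor A B ^ n = tensor (A ^ n) (B ^ n) := by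
  induction n with
  | zero => simp [tensor_one]
  | succ n ih => rw [pow_succ, ih, tensor_mul, ← pow_succ, ← pow_succ]

theorem tensor_mem_phasedClifford {A B : U2} (n : ℕ) (hA : A ^ (n + 1) = 1) (hB : B ^ (n + 1) = 1)
    (hA' : ∀ s ∈ pauliMatrices, A * s * A⁻¹ ∈ Subgroup.closure pauliMatrices)
    (hB' : ∀ s ∈ pauliMatrices, B * s * B⁻¹ ∈ Subgroup.closure pauliMatrices) :
    tensor A B ∈ phasedClifford := by
  refine mem_normalizer_closure_of_pow n (by rw [tensor_pow, hA, hB, tensor_one]) ?_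
  rintro _ ⟨s, hs, t, ht, rfl⟩
  rw [tensor_inv, tensor_mul, tensor_mul]
  exact tensor_mem (hA' s hs) (hB' t ht)

theorem one_conj {s : U2} (hs : s ∈ pauliMatrices) :
    1 * s * 1⁻¹ ∈ Subgroup.closure pauliMatrices := by
  simpa using Subgroup.subset_closure hs

theorem controlledZ_sq : controlledZ * controlledZ = 1 := by
  ext ⟨i, i'⟩ ⟨j, j'⟩
  fin_cases i <;> fin_cases i' <;> fin_cases j <;> fin_cases j' <;>
    simp [controlledZ, Matrix.mul_apply, Fintype.sum_prod_type, Matrix.one_apply]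

theorem controlledZ_X_one : controlledZ * tensor pauliX 1 =
    tensor pauliX pauliZ * controlledZ := by
  ext ⟨i, i'⟩ ⟨j, j'⟩
  fin_cases i <;> fin_cases i' <;> fin_cases j <;> fin_cases j' <;>
    simp [controlledZ, tensor, pauliX, pauliZ, Matrix.mul_apply, Fintype.sum_prod_type,
      Matrix.one_apply]

theorem controlledZ_Y_one : controlledZ * tensor pauliY 1 =
    tensor pauliY pauliZ * controlledZ := by
  ext ⟨i, i'⟩ ⟨j, j'⟩
  fin_cases i <;> fin_cases i' <;> fin_cases j <;> fin_cases j' <;>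
    simp [controlledZ, tensor, pauliY, pauliZ, Matrix.mul_apply, Fintype.sum_prod_type,
      Matrix.one_apply]

theorem controlledZ_Z_one : controlledZ * tensor pauliZ 1 =
    tensor pauliZ 1 * controlledZ := by
  ext ⟨i, i'⟩ ⟨j, j'⟩
  fin_cases i <;> fin_cases i' <;> fin_cases j <;> fin_cases j' <;>
    simp [controlledZ, tensor, pauliZ, Matrix.mul_apply, Fintype.sum_prod_type,
      Matrix.one_apply]

theorem controlledZ_one_X : controlledZ * tensor 1 pauliX =
    tensor pauliZ pauliX * controlledZ := by
  ext ⟨i, i'⟩ ⟨j, j'⟩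
  fin_cases i <;> fin_cases i' <;> fin_cases j <;> fin_cases j' <;>
    simp [controlledZ, tensor, pauliX, pauliZ, Matrix.mul_apply, Fintype.sum_prod_type,
      Matrix.one_apply]

theorem controlledZ_one_Y : controlledZ * tensor 1 pauliY =
    tensor pauliZ pauliY * controlledZ := by
  ext ⟨i, i'⟩ ⟨j, j'⟩
  fin_cases i <;> fin_cases i' <;> fin_cases j <;> fin_cases j' <;>
    simp [controlledZ, tensor, pauliY, pauliZ, Matrix.mul_apply, Fintype.sum_prod_type,
      Matrix.one_apply]

theorem controlledZ_one_Z : controlledZ * tensor 1 pauliZ =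
    tensor 1 pauliZ * controlledZ := by
  ext ⟨i, i'⟩ ⟨j, j'⟩
  fin_cases i <;> fin_cases i' <;> fin_cases j <;> fin_cases j' <;>
    simp [controlledZ, tensor, pauliZ, Matrix.mul_apply, Fintype.sum_prod_type,
      Matrix.one_apply]

theorem controlledZ_mem : controlledZ ∈ phasedClifford := by
  have hx := Subgroup.subset_closure pauliX_mem
  have hy := Subgroup.subset_closure pauliY_mem
  have hz := Subgroup.subset_closure pauliZ_mem
  have h1 := one_mem (Subgroup.closure pauliMatrices)
  have hl : ∀ s ∈ pauliMatrices, controlledZ * tensor s 1 * controlledZ⁻¹ ∈ phasedPauli := by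
    rintro s (rfl | rfl | rfl | rfl)
    · rw [tensor_one, mul_one, mul_inv_cancel]; exact one_mem _
    · rw [controlledZ_X_one, mul_inv_cancel_right]; exact tensor_mem hx hz
    · rw [controlledZ_Y_one, mul_inv_cancel_right]; exact tensor_mem hy hz
    · rw [controlledZ_Z_one, mul_inv_cancel_right]; exact tensor_mem hz h1
  have hr : ∀ s ∈ pauliMatrices, controlledZ * tensor 1 s * controlledZ⁻¹ ∈ phasedPauli := by
    rintro s (rfl | rfl | rfl | rfl)
    · rw [tensor_one, mul_one, mul_inv_cancel]; exact one_mem _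
    · rw [controlledZ_one_X, mul_inv_cancel_right]; exact tensor_mem hz hx
    · rw [controlledZ_one_Y, mul_inv_cancel_right]; exact tensor_mem hz hy
    · rw [controlledZ_one_Z, mul_inv_cancel_right]; exact tensor_mem h1 hz
  refine mem_normalizer_closure_of_pow 1 (by rw [pow_succ, pow_one, controlledZ_sq]) ?_
  rintro _ ⟨s, hs, t, ht, rfl⟩
  have e : controlledZ * tensor s t * controlledZ⁻¹ =
      (controlledZ * tensor s 1 * controlledZ⁻¹) * (controlledZ * tensor 1 t * controlledZ⁻¹) := by
    have : tensor s t = tensor s 1 * tensor 1 t := by rw [tensor_mul, mul_one, one_mul]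
    rw [this]; group
  rw [e]
  exact mul_mem (hl s hs) (hr t ht)

/-- The Clifford element `H₁ = H ⊗ I`. -/
def H₁ : CliffordGroup := toClifford ⟨tensor hadamard 1,
  tensor_mem_phasedClifford 1 (by rw [pow_succ, pow_one, hadamard_sq]) (one_pow _)
    (fun _ => hadamard_conj) (fun _ => one_conj)⟩

/-- The Clifford element `H₂ = I ⊗ H`. -/
def H₂ : CliffordGroup := toClifford ⟨tensor 1 hadamard,
  tensor_mem_phasedClifford 1 (one_pow _) (by rw [pow_succ, pow_one, hadamard_sq])
    (fun _ => one_conj) (fun _ => hadamard_conj)⟩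

/-- The Clifford element `P₁ = P ⊗ I`. -/
def P₁ : CliffordGroup := toClifford ⟨tensor phase 1,
  tensor_mem_phasedClifford 3 phase_pow (one_pow _) (fun _ => phase_conj) (fun _ => one_conj)⟩

/-- The Clifford element `P₂ = I ⊗ P`. -/
def P₂ : CliffordGroup := toClifford ⟨tensor 1 phase,
  tensor_mem_phasedClifford 3 (one_pow _) phase_pow (fun _ => one_conj) (fun _ => phase_conj)⟩

/-- The Clifford element `Z` given by the controlled-`Z` gate. -/
def CZ : CliffordGroup := toClifford ⟨controlledZ, controlledZ_mem⟩

/-! ### Characters -/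

/-- The irreducible complex characters of a group: the characters of its finite-dimensional
irreducible complex representations. -/
def irreducibleCharacters (G : Type*) [Group G] : Set (G → ℂ) :=
  {χ | ∃ (V : Type) (_ : AddCommGroup V) (_ : Module ℂ V) (ρ : Representation ℂ G V),
    FiniteDimensional ℂ V ∧ ρ.IsIrreducible ∧ χ = ρ.character}

/-- A homomorphism to the signs `{±1}`, viewed as a linear character with values in `ℂˣ`. -/
def signToLinear {G : Type*} [Group G] (s : G →* ℤˣ) : G →* ℂˣ :=
  (Units.map (Int.castRingHom ℂ : ℤ →* ℂ)).comp s

end TwoQubit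

end

/-!
The unitary group `U(4)` acts on the antisymmetric `4 × 4` matrices by `A ↦ U A Uᵀ`; this is the
exterior square of `ℂ⁴`, and it underlies the isogeny `SU(4) → SO(6)`. Six of the two-qubit Pauli
matrices are antisymmetric, and they form a basis. A Clifford matrix `U` permutes them up to
scalars, since `U A Uᵀ = (U A U⁻¹) (U Uᵀ)` and `U Uᵀ` is itself a multiple of a Pauli matrix
(`clifford_mul_transpose`). After division by a common scalar the remaining scalars are signs
(`Acts.exists_of_clifford`), the resulting signed permutation is unique up to `-1`
(`Acts.eq_or_eq`) and has determinant one (`Acts.det_eq_one`), and it determines `U` up to a phase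
(`Acts.toClifford_eq`). Conversely the gates act by adjacent swaps up to signs, and the Pauli
matrices act by the diagonal sign matrices of determinant one, so all signed permutations of
determinant one occur (`mem_realized_of_det`). Hence the Clifford group is the quotient by `±1` of
the group of signed permutations of six points of determinant one (`isCover_cover`), an extension of
`S₆` by the Pauli group, which is the group of diagonal matrices of determinant one modulo `±1`.

The claims are then proved for every such quotient (`SignedPerm.IsCover`). The order is
`2⁵ · 720 / 2 = 11520`. The nontrivial elements of the diagonal group are conjugate to each other,
and every nontrivial normal subgroup meets that group nontrivially, so nontrivial normal subgroups
are preimages of normal subgroups of `S₆`, where `A₆` is simple (`IsCover.normal_eq`). The sign of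
the permutation in `S₆` is the only nontrivial linear character, and each of the five gates is an
odd permutation. For the conjugacy classes, representatives are listed by cycle type and signs: a
finite search shows that each element is conjugate to one of them, and the cycle type, the square of
the trace and the trace of the square tell them apart (`IsCover.card_conjClasses`).

That there are as many irreducible characters as conjugacy classes is proved for all finite groups
(`ncard_irreducibleCharacters`): the characters are orthonormal, and a class function orthogonal to
all of them gives a central element of the group algebra that kills every simple module, hence
vanishes.
-/

noncomputable section

namespace TwoQubit

/-! ### Irreducible characters and class functions -/

/-- The complex class functions on a group: the functions invariant under conjugation. -/
def classFunctions (G : Type*) [Group G] : Submodule ℂ (G → ℂ) where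
  carrier := {f | ∀ g h, f (h * g * h⁻¹) = f g}
  add_mem' hf hf' g h := by simp [hf g h, hf' g h]
  zero_mem' _ _ := rfl
  smul_mem' c f hf g h := by simp [hf g h]

/-- A class function is the same thing as a function on the set of conjugacy classes. -/
def classFunctionsEquiv (G : Type*) [Group G] :
    (ConjClasses G → ℂ) ≃ₗ[ℂ] classFunctions G where
  toFun f := ⟨fun g => f (ConjClasses.mk g), fun g h => congrArg f <|
    ConjClasses.mk_eq_mk_iff_isConj.2 (isConj_iff.2 ⟨h⁻¹, by group⟩)⟩
  map_add' _ _ := rfl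
  map_smul' _ _ := rfl
  invFun f := Quotient.lift f.1 fun a b hab => by
    obtain ⟨c, rfl⟩ := isConj_iff.1 hab
    exact (f.2 a c).symm
  left_inv f := by
    funext x
    induction x using Quotient.inductionOn with | _ g => rfl
  right_inv _ := rfl

theorem finrank_classFunctions (G : Type*) [Group G] [Finite G] :
    Module.finrank ℂ (classFunctions G) = Nat.card (ConjClasses G) := by
  have := Fintype.ofFinite (ConjClasses G)
  rw [← (classFunctionsEquiv G).finrank_eq, Module.finrank_fintype_fun_eq_card,
    Nat.card_eq_fintype_card]

section CharacterTheory

open scoped MonoidAlgebra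

variable {G : Type} [Group G]

theorem irreducibleCharacters_subset_classFunctions :
    irreducibleCharacters G ⊆ classFunctions G := by
  rintro _ ⟨V, _, _, ρ, _, _, rfl⟩ g h
  exact ρ.char_conj g h

/-- A simple module over the group algebra is an irreducible representation. -/
theorem isIrreducible_ofModule' (M : Type) [AddCommGroup M] [Module ℂ M] [Module ℂ[G] M]
    [IsScalarTower ℂ ℂ[G] M] [IsSimpleModule ℂ[G] M] :
    (Representation.ofModule' (k := ℂ) (G := G) M).IsIrreducible where
  exists_pair_ne := by
    have := IsSimpleModule.nontrivial ℂ[G] M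
    obtain ⟨x, hx⟩ := exists_ne (0 : M)
    refine ⟨⊥, ⊤, fun h => hx ?_⟩
    have hx' : x ∈ (⊤ : Subrepresentation (Representation.ofModule' (k := ℂ) (G := G) M)) :=
      Submodule.mem_top
    rw [← h] at hx'
    exact hx'
  eq_bot_or_eq_top p := by
    let q : Submodule ℂ[G] M :=
      { p.toSubmodule.toAddSubmonoid with
        smul_mem' := fun z m hm => by
          induction z using MonoidAlgebra.induction_on with
          | of g =>
            have := p.apply_mem_toSubmodule g hm
            simpa [Representation.ofModule'] using this
          | add a b ha hb => rw [add_smul]; exact p.toSubmodule.add_mem ha hb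
          | smul c a ha => rw [smul_assoc]; exact p.toSubmodule.smul_mem c ha }
    have hq : ∀ x, x ∈ q ↔ x ∈ p.toSubmodule := fun _ => Iff.rfl
    refine (eq_bot_or_eq_top q).imp (fun h => ?_) fun h => ?_
    · refine Subrepresentation.ext (Submodule.ext fun x => ?_)
      rw [← hq, h]; rfl
    · refine Subrepresentation.ext (Submodule.ext fun x => ?_)
      rw [← hq, h]; rfl

variable [Fintype G]

/-- The bilinear pairing `|G|⁻¹ ∑ h(g) f(g⁻¹)` for which irreducible characters are orthonormal, as
a linear form in `h`. -/
def charPairing (f : G → ℂ) : (G → ℂ) →ₗ[ℂ] ℂ where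
  toFun h := (Nat.card G : ℂ)⁻¹ * ∑ g : G, h g * f g⁻¹
  map_add' h h' := by simp [add_mul, Finset.sum_add_distrib, mul_add]
  map_smul' c h := by simp [Finset.mul_sum, mul_assoc, mul_left_comm]

theorem charPairing_comm (f h : G → ℂ) : charPairing f h = charPairing h f := by
  refine congrArg ((Nat.card G : ℂ)⁻¹ * ·) ?_
  exact Fintype.sum_equiv (Equiv.inv G) _ _ fun g => by simp [mul_comm]

theorem charPairing_irreducible {χ ψ : G → ℂ} (hχ : χ ∈ irreducibleCharacters G)
    (hψ : ψ ∈ irreducibleCharacters G) [Decidable (χ = ψ)] :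
    charPairing ψ χ = if χ = ψ then 1 else 0 := by
  obtain ⟨V, _, _, ρ, _, hρ, rfl⟩ := hχ
  obtain ⟨W, _, _, σ, _, hσ, rfl⟩ := hψ
  have : Invertible (Nat.card G : ℂ) := invertibleOfNonzero (Nat.cast_ne_zero.2 Nat.card_pos.ne')
  have hne : (Nat.card G : ℂ) ≠ 0 := Nat.cast_ne_zero.2 Nat.card_pos.ne'
  split_ifs with h
  · have key := Representation.char_orthonormal (k := ℂ) ρ ρ
    rw [if_pos ⟨Representation.Equiv.refl ρ⟩] at key
    change (Nat.card G : ℂ)⁻¹ * ∑ g : G, ρ.character g * σ.character g⁻¹ = 1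
    rw [← h]
    simpa using key
  · have key := Representation.char_orthonormal (k := ℂ) ρ σ
    rw [if_neg fun ⟨e⟩ => h (Representation.char_iso e).symm] at key
    exact key

theorem linearIndependent_irreducibleCharacters :
    LinearIndependent ℂ (Subtype.val : irreducibleCharacters G → G → ℂ) := by
  classical
  rw [linearIndependent_iff']
  intro s c hc χ hχ
  have h := congrArg (charPairing χ.1) hc
  rw [map_sum, map_zero, Finset.sum_eq_single_of_mem χ hχ] at h
  · simpa [charPairing_irreducible χ.2 χ.2] using h
  · intro ψ _ hψ
    rw [map_smul, charPairing_irreducible ψ.2 χ.2, if_neg fun h => hψ (Subtype.ext h), smul_zero]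

/-- The element `∑ f(g⁻¹) g` of the group algebra. It is central when `f` is a class function. -/
def classElement (f : G → ℂ) : ℂ[G] := ∑ g : G, MonoidAlgebra.single g (f g⁻¹)

/-- By Schur's lemma the central element attached to a class function acts on an irreducible
representation by a scalar; its trace there is `|G|` times the pairing with the character. -/
theorem asAlgebraHom_classElement_eq_zero {f : G → ℂ} (hf : f ∈ classFunctions G)
    (horth : ∀ χ ∈ irreducibleCharacters G, charPairing f χ = 0)
    {V : Type} [AddCommGroup V] [Module ℂ V] [FiniteDimensional ℂ V] (ρ : Representation ℂ G V)
    [ρ.IsIrreducible] : ρ.asAlgebraHom (classElement f) = 0 := by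
  set T := ρ.asAlgebraHom (classElement f) with hT
  have hTsum : T = ∑ g : G, f g⁻¹ • ρ g := by
    simp [hT, classElement, map_sum]
  have hcomm : ∀ h : G, T ∘ₗ ρ h = ρ h ∘ₗ T := by
    intro h
    change T * ρ h = ρ h * T
    rw [hTsum, Finset.sum_mul, Finset.mul_sum]
    refine Fintype.sum_equiv (MulAut.conj h⁻¹).toEquiv _ _ fun g => ?_
    have h1 : f (h⁻¹ * g * h)⁻¹ = f g⁻¹ := by
      rw [← hf g⁻¹ h⁻¹]; congr 1; group
    simp only [MulEquiv.toEquiv_eq_coe, MulEquiv.coe_toEquiv, MulAut.conj_apply, inv_inv]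
    rw [h1, smul_mul_assoc, mul_smul_comm, ← map_mul, ← map_mul]
    congr 2; group
  obtain ⟨c, hc⟩ :=
    (Representation.IsIrreducible.algebraMap_intertwiningMap_bijective_of_isAlgClosed
      (ρ := ρ)).2 ⟨T, hcomm⟩
  have hcT : T = c • LinearMap.id := by
    have := congrArg Representation.IntertwiningMap.toLinearMap hc
    exact this.symm
  have htr : LinearMap.trace ℂ V T = 0 := by
    have h := horth _ ⟨V, _, _, ρ, inferInstance, inferInstance, rfl⟩
    have h' : ∑ g : G, ρ.character g * f g⁻¹ = 0 := by
      have hne : (Nat.card G : ℂ) ≠ 0 := Nat.cast_ne_zero.2 Nat.card_pos.ne'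
      exact (mul_eq_zero.1 h).resolve_left (inv_ne_zero hne)
    rw [hTsum, map_sum, ← h']
    exact Finset.sum_congr rfl fun g _ => by simp [Representation.character, mul_comm]
  have : Nontrivial V := by
    by_contra hV
    rw [not_nontrivial_iff_subsingleton] at hV
    exact bot_ne_top (α := Subrepresentation ρ)
      (Subrepresentation.ext (Subsingleton.elim _ _))
  rw [hcT, map_smul, LinearMap.trace_id, smul_eq_mul, mul_eq_zero] at htr
  rw [hcT, htr.resolve_right (Nat.cast_ne_zero.2 Module.finrank_pos.ne'), zero_smul]

/-- Irreducible characters separate class functions: the attached element of the group algebra kills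
every simple module, hence kills the semisimple regular module, hence is zero. -/
theorem eq_zero_of_orthogonal {f : G → ℂ} (hf : f ∈ classFunctions G)
    (horth : ∀ χ ∈ irreducibleCharacters G, charPairing f χ = 0) : f = 0 := by
  have hz : classElement f ∈ Module.annihilator ℂ[G] ℂ[G] := by
    rw [← Submodule.annihilator_top, ← IsSemisimpleModule.sSup_simples_eq_top, sSup_eq_iSup',
      Submodule.annihilator_iSup]
    simp only [Submodule.mem_iInf]
    rintro ⟨S, hS⟩
    have hS : IsSimpleModule ℂ[G] S := hS
    have := isIrreducible_ofModule' (G := G) S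
    have : FiniteDimensional ℂ ℂ[G] := inferInstance
    have : FiniteDimensional ℂ S :=
      inferInstanceAs (FiniteDimensional ℂ (S.restrictScalars ℂ))
    have h0 := asAlgebraHom_classElement_eq_zero hf horth
      (Representation.ofModule' (k := ℂ) (G := G) S)
    rw [Submodule.mem_annihilator]
    intro x hx
    have h1 := LinearMap.congr_fun h0 ⟨x, hx⟩
    simp only [Representation.asAlgebraHom_def, Representation.ofModule', Equiv.apply_symm_apply]
      at h1
    exact congrArg Subtype.val h1
  have h1 := (Module.mem_annihilator.1 hz) 1
  rw [smul_eq_mul, mul_one] at h1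
  classical
  funext g
  have := DFunLike.congr_fun (congrArg MonoidAlgebra.coeff h1) g⁻¹
  simpa [classElement, MonoidAlgebra.coeff_sum, Finsupp.finsetSum_apply, Finsupp.single_apply]
    using this

theorem span_irreducibleCharacters :
    Submodule.span ℂ (irreducibleCharacters G) = classFunctions G := by
  classical
  refine le_antisymm (Submodule.span_le.2 irreducibleCharacters_subset_classFunctions) ?_
  intro f hf
  have : Finite (irreducibleCharacters G) :=
    linearIndependent_irreducibleCharacters.finite
  have := Fintype.ofFinite (irreducibleCharacters G)
  -- Subtracting from `f` its expansion in irreducible characters leaves a function orthogonal to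
  -- all of them.
  set p : G → ℂ := ∑ ψ : irreducibleCharacters G, charPairing ψ.1 f • ψ.1 with hp
  have hpspan : p ∈ Submodule.span ℂ (irreducibleCharacters G) :=
    Submodule.sum_mem _ fun ψ _ => Submodule.smul_mem _ _ (Submodule.subset_span ψ.2)
  have hpclass := Submodule.span_le.2 irreducibleCharacters_subset_classFunctions hpspan
  have h0 : f - p = 0 := by
    refine eq_zero_of_orthogonal (Submodule.sub_mem _ hf hpclass) fun χ hχ => ?_
    rw [charPairing_comm, map_sub, hp, map_sum,
      Finset.sum_eq_single_of_mem ⟨χ, hχ⟩ (Finset.mem_univ _), map_smul,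
      charPairing_irreducible hχ hχ, if_pos rfl, smul_eq_mul, mul_one, sub_self]
    intro ψ _ hψ
    rw [map_smul, charPairing_irreducible ψ.2 hχ, if_neg fun h => hψ (Subtype.ext h), smul_zero]
  rw [sub_eq_zero.1 h0]
  exact hpspan

theorem ncard_irreducibleCharacters (G : Type) [Group G] [Finite G] :
    (irreducibleCharacters G).ncard = Nat.card (ConjClasses G) := by
  have := Fintype.ofFinite G
  have hli := linearIndependent_irreducibleCharacters (G := G)
  have : Finite (irreducibleCharacters G) := hli.finite
  have := Fintype.ofFinite (irreducibleCharacters G)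
  rw [← finrank_classFunctions, ← span_irreducibleCharacters, finrank_span_set_eq_card hli,
    Set.ncard_eq_toFinset_card']

end CharacterTheory

/-! ### Signed permutations of six points -/

open Equiv Subgroup

/-- The signed permutations of six points, `{±1}⁶ ⋊ S₆`. The element `⟨ε, π⟩` stands for the
monomial matrix that sends the basis vector `e a` to `ε (π a) • e (π a)`, so that signs are indexed
by the target. -/
abbrev SignedPerm : Type := (Fin 6 → ℤˣ) ⋊[mulAutArrow] Perm (Fin 6)

namespace SignedPerm

theorem mul_left_apply (g h : SignedPerm) (a : Fin 6) :
    (g * h).left a = g.left a * h.left (g.right⁻¹ a) := rfl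

theorem inv_left_apply (g : SignedPerm) (a : Fin 6) :
    g⁻¹.left a = (g.left (g.right a))⁻¹ := by
  rw [SemidirectProduct.inv_left]
  change (g.left ((g.right⁻¹)⁻¹ a))⁻¹ = _
  rw [inv_inv]

/-- The determinant of the monomial matrix of a signed permutation. -/
def det : SignedPerm →* ℤˣ where
  toFun g := (∏ a, g.left a) * Perm.sign g.right
  map_one' := by simp
  map_mul' g h := by
    have : ∏ a, h.left (g.right⁻¹ a) = ∏ a, h.left a := Equiv.prod_comp g.right⁻¹ h.left
    simp only [mul_left_apply, Finset.prod_mul_distrib, this, SemidirectProduct.mul_right, map_mul]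
    exact mul_mul_mul_comm _ _ _ _

theorem det_apply (g : SignedPerm) : det g = (∏ a, g.left a) * Perm.sign g.right := rfl

/-- The scalar `-1`: all six signs changed, no point moved. -/
def negOne : SignedPerm := SemidirectProduct.inl fun _ => -1

theorem negOne_mul_left (g : SignedPerm) (a : Fin 6) : (negOne * g).left a = -g.left a := by
  rw [mul_left_apply]; exact neg_one_mul _

theorem negOne_mul_right (g : SignedPerm) : (negOne * g).right = g.right := one_mul _

theorem det_negOne : det negOne = 1 := by decide

/-- The trace of the monomial matrix of a signed permutation. -/
def trace (g : SignedPerm) : ℤ := ∑ a, if g.right a = a then (g.left a : ℤ) else 0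

theorem trace_negOne_mul (g : SignedPerm) : trace (negOne * g) = -trace g := by
  simp only [trace, negOne_mul_left, negOne_mul_right, ← Finset.sum_neg_distrib]
  exact Finset.sum_congr rfl fun a _ => by split_ifs <;> simp

theorem trace_conj (g h : SignedPerm) : trace (h * g * h⁻¹) = trace g := by
  unfold trace
  rw [← Equiv.sum_comp h.right]
  refine Finset.sum_congr rfl fun a _ => ?_
  have hr : (h * g * h⁻¹).right (h.right a) = h.right (g.right a) := by simp
  simp only [hr, EmbeddingLike.apply_eq_iff_eq]
  split_ifs with ha
  · have ha' : Equiv.symm g.right a = a := by rw [Equiv.symm_apply_eq, ha]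
    rw [mul_left_apply, mul_left_apply, inv_left_apply]
    simp [ha', -Units.val_mul]
    rw [mul_right_comm, Int.units_mul_self, one_mul]
  · rfl

theorem negOne_mul_comm (g : SignedPerm) : negOne * g = g * negOne := by
  refine SemidirectProduct.ext (funext fun a => ?_) ?_
  · rw [negOne_mul_left, mul_left_apply]; exact (mul_neg_one _).symm
  · exact (one_mul _).trans (mul_one _).symm

theorem negOne_mul_negOne : negOne * negOne = 1 := by decide

theorem det_surjective : Function.Surjective det := by
  intro u
  refine ⟨SemidirectProduct.inl (Function.update 1 0 u), ?_⟩
  revert u; decide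

theorem card_det_ker : Nat.card det.ker = 23040 := by
  have h := Subgroup.card_eq_card_quotient_mul_card_subgroup det.ker
  rw [Nat.card_congr (QuotientGroup.quotientKerEquivOfSurjective det det_surjective).toEquiv,
    SemidirectProduct.card] at h
  simp [Nat.card_eq_fintype_card, Fintype.card_perm, Nat.factorial] at h
  have : Nat.card det.ker = Nat.card {x // det x = 1} := rfl
  omega

theorem negOne_ne_one : negOne ≠ 1 := by decide

theorem exists_det_eq_one (π : Perm (Fin 6)) : ∃ g : SignedPerm, det g = 1 ∧ g.right = π := by
  refine ⟨⟨Function.update 1 0 (Perm.sign π), π⟩, ?_, rfl⟩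
  rw [det_apply, Finset.prod_update_of_mem (Finset.mem_univ _)]
  simp

/-- The diagonal element that changes the signs at `a` and `b`. -/
def flip (a b : Fin 6) : SignedPerm :=
  SemidirectProduct.inl fun c => if c = a ∨ c = b then -1 else 1

theorem det_flip {a b : Fin 6} (h : a ≠ b) : det (flip a b) = 1 := by
  revert a b; decide +kernel

theorem conj_flip (g : SignedPerm) (a b : Fin 6) :
    g * flip a b * g⁻¹ = flip (g.right a) (g.right b) := by
  refine SemidirectProduct.ext (funext fun c => ?_) ?_
  · obtain ⟨c, rfl⟩ := g.right.surjective c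
    rw [mul_left_apply, mul_left_apply, inv_left_apply]
    simp [flip]
  · simp [flip]

/-- Modulo `-1` the nontrivial diagonal elements of determinant one are the flips: a set of four
signs is the complement of a set of two. -/
theorem exists_eq_flip {g : SignedPerm} (hg : det g = 1) (hr : g.right = 1) (h1 : g ≠ 1)
    (h2 : g ≠ negOne) : ∃ a b, a ≠ b ∧ (g = flip a b ∨ g = negOne * flip a b) := by
  obtain ⟨l, r⟩ := g
  obtain rfl : r = 1 := hr
  simp only [SemidirectProduct.ext_iff, ne_eq] at h1 h2 ⊢
  revert l; decide +kernel

/-- The four points involved are pairwise distinct, except that `c = d` and `a = d` are allowed. -/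
theorem flip_mul_flip_ne {a b c d : Fin 6} (hab : b ≠ a) (hac : a ≠ c) (hbc : b ≠ c) (hbd : b ≠ d) :
    flip b d * (flip a c)⁻¹ ≠ 1 ∧ flip b d * (flip a c)⁻¹ ≠ negOne := by
  simp only [SemidirectProduct.ext_iff, ne_eq]
  revert a b c d; decide +kernel

theorem exists_perm_pair {a b c d : Fin 6} (hab : a ≠ b) (hcd : c ≠ d) :
    ∃ π : Perm (Fin 6), π a = c ∧ π b = d := by
  refine ⟨swap (swap a c b) d * swap a c, ?_, by simp⟩
  have h : c ≠ swap a c b := fun h => hab ((swap a c).injective (by rw [swap_apply_left]; exact h))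
  rw [Perm.mul_apply, swap_apply_left, swap_apply_of_ne_of_ne h hcd]

theorem exists_ne_ne (a b : Fin 6) : ∃ c, a ≠ c ∧ b ≠ c := by
  decide +revert

/-! ### Quotients of the group of signed permutations of determinant one by `±1` -/

/-- The homomorphism `Ψ` presents `G` as the quotient by `±1` of the group of signed permutations of
determinant one. -/
structure IsCover {G : Type*} [Group G] (Ψ : det.ker →* G) : Prop where
  surjective : Function.Surjective Ψ
  eq_one_iff : ∀ g, Ψ g = 1 ↔ g.1 = 1 ∨ g.1 = negOne

namespace IsCover

variable {G : Type*} [Group G] {Ψ : det.ker →* G} (hΨ : IsCover Ψ)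
include hΨ

theorem eq_iff (g h : det.ker) : Ψ g = Ψ h ↔ g.1 = h.1 ∨ g.1 = negOne * h.1 := by
  rw [← mul_inv_eq_one, ← map_inv, ← map_mul, hΨ.eq_one_iff]
  simp [mul_inv_eq_iff_eq_mul]

theorem finite : Finite G :=
  have : Finite SignedPerm := Finite.of_equiv _ SemidirectProduct.equivProd.symm
  Finite.of_surjective Ψ hΨ.surjective

theorem card_eq : Nat.card G = 11520 := by
  have h := Subgroup.card_eq_card_quotient_mul_card_subgroup Ψ.ker
  rw [Nat.card_congr (QuotientGroup.quotientKerEquivOfSurjective Ψ hΨ.surjective).toEquiv,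
    card_det_ker] at h
  have hk : Nat.card Ψ.ker = 2 := by
    rw [Nat.card_eq_two_iff]
    refine ⟨1, ⟨⟨negOne, det_negOne⟩, (hΨ.eq_one_iff _).2 (Or.inr rfl)⟩, ?_, ?_⟩
    · intro h
      exact negOne_ne_one (congrArg (fun x => x.1.1) h).symm
    · refine Set.eq_univ_of_forall fun x => ?_
      rcases (hΨ.eq_one_iff x.1).1 x.2 with h | h
      · exact Or.inl (Subtype.ext (Subtype.ext h))
      · exact Or.inr (Subtype.ext (Subtype.ext h))
  rw [hk] at h
  omega

/-- The permutation of the six coordinate lines defined by an element of the quotient. -/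
def perm : G →* Perm (Fin 6) :=
  Ψ.liftOfSurjective hΨ.surjective ⟨SemidirectProduct.rightHom.comp det.ker.subtype, by
    intro g hg
    rcases (hΨ.eq_one_iff g).1 hg with h | h
    · simp [MonoidHom.mem_ker, h]
    · simp [MonoidHom.mem_ker, h, negOne]⟩

theorem perm_apply (g : det.ker) : hΨ.perm (Ψ g) = g.1.right :=
  Ψ.liftOfRightInverse_comp_apply _ (Function.rightInverse_surjInv hΨ.surjective) _ g

theorem perm_surjective : Function.Surjective hΨ.perm := by
  intro π
  obtain ⟨g, hg, rfl⟩ := exists_det_eq_one π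
  exact ⟨Ψ ⟨g, hg⟩, hΨ.perm_apply _⟩

theorem card_perm_ker : Nat.card hΨ.perm.ker = 16 := by
  have h := Subgroup.card_eq_card_quotient_mul_card_subgroup hΨ.perm.ker
  rw [Nat.card_congr (QuotientGroup.quotientKerEquivOfSurjective _ hΨ.perm_surjective).toEquiv,
    hΨ.card_eq, Nat.card_eq_fintype_card, Fintype.card_perm] at h
  simp [Nat.factorial] at h
  have : Nat.card hΨ.perm.ker = Nat.card {x // hΨ.perm x = 1} := rfl
  omega

theorem exists_eq_flip {p : G} (hp : hΨ.perm p = 1) (hp1 : p ≠ 1) :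
    ∃ a b, ∃ h : a ≠ b, p = Ψ ⟨flip a b, det_flip h⟩ := by
  obtain ⟨g, rfl⟩ := hΨ.surjective p
  rw [hΨ.perm_apply] at hp
  rw [Ne, hΨ.eq_one_iff, not_or] at hp1
  obtain ⟨a, b, hab, h⟩ := SignedPerm.exists_eq_flip g.2 hp hp1.1 hp1.2
  exact ⟨a, b, hab, (hΨ.eq_iff _ _).2 h⟩

/-- The kernel of `perm` is a minimal normal subgroup: its nontrivial elements are the fifteen
flips, which are conjugate to each other. -/
theorem perm_ker_le_of_mem {N : Subgroup G} [N.Normal] {p : G} (hp : hΨ.perm p = 1) (hp1 : p ≠ 1)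
    (hpN : p ∈ N) : hΨ.perm.ker ≤ N := by
  intro q hq
  by_cases hq1 : q = 1
  · rw [hq1]; exact one_mem N
  obtain ⟨a, b, hab, rfl⟩ := hΨ.exists_eq_flip hp hp1
  obtain ⟨c, d, hcd, rfl⟩ := hΨ.exists_eq_flip hq hq1
  obtain ⟨π, rfl, rfl⟩ := exists_perm_pair hab hcd
  obtain ⟨g, hg, rfl⟩ := exists_det_eq_one π
  have := Subgroup.Normal.conj_mem inferInstance _ hpN (Ψ ⟨g, hg⟩)
  rw [← map_inv, ← map_mul, ← map_mul] at this
  convert this using 2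
  exact Subtype.ext (conj_flip g a b).symm

/-- The kernel of `perm` lies in every nontrivial normal subgroup. An element outside the kernel
moves some point, and its commutator with a suitable flip is then a nontrivial element of the
kernel. -/
theorem perm_ker_le {N : Subgroup G} [N.Normal] (hN : N ≠ ⊥) : hΨ.perm.ker ≤ N := by
  obtain ⟨x, hxN, hx1⟩ := N.bot_or_exists_ne_one.resolve_left hN
  by_cases hx : hΨ.perm x = 1
  · exact hΨ.perm_ker_le_of_mem hx hx1 hxN
  obtain ⟨g, rfl⟩ := hΨ.surjective x
  rw [hΨ.perm_apply] at hx
  obtain ⟨a, ha⟩ : ∃ a, g.1.right a ≠ a := by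
    by_contra! h
    exact hx (Equiv.ext h)
  obtain ⟨c, hc⟩ := exists_ne_ne a (g.1.right a)
  have hinj : g.1.right a ≠ g.1.right c := fun h => hc.1 (g.1.right.injective h)
  set p : det.ker := ⟨flip a c, det_flip hc.1⟩
  set q : det.ker := ⟨flip (g.1.right a) (g.1.right c), det_flip hinj⟩
  have hq : g * p * g⁻¹ = q := Subtype.ext (conj_flip g.1 a c)
  have hmem : Ψ (q * p⁻¹) ∈ N := by
    rw [← hq, mul_assoc, mul_assoc, map_mul]
    refine N.mul_mem hxN ?_
    have := Subgroup.Normal.conj_mem inferInstance _ (N.inv_mem hxN) (Ψ p)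
    rwa [← map_inv, ← map_inv, ← map_mul, ← map_mul, mul_assoc] at this
  refine hΨ.perm_ker_le_of_mem ?_ ?_ hmem
  · rw [hΨ.perm_apply]; rfl
  · rw [Ne, hΨ.eq_one_iff, not_or]
    exact flip_mul_flip_ne ha hc.1 hc.2 hinj

/-- The sign of the permutation of the six coordinate lines. -/
def sgn : G →* ℤˣ := Perm.sign.comp hΨ.perm

theorem sgn_apply (x : G) : hΨ.sgn x = Perm.sign (hΨ.perm x) := rfl

theorem card_sgn_ker : Nat.card hΨ.sgn.ker = 5760 := by
  have hs : Function.Surjective hΨ.sgn := (Perm.sign_surjective (Fin 6)).comp hΨ.perm_surjective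
  have h := Subgroup.card_eq_card_quotient_mul_card_subgroup hΨ.sgn.ker
  rw [Nat.card_congr (QuotientGroup.quotientKerEquivOfSurjective _ hs).toEquiv,
    hΨ.card_eq, Nat.card_eq_fintype_card] at h
  simp at h
  have : Nat.card hΨ.sgn.ker = Nat.card {x // hΨ.sgn x = 1} := rfl
  omega

/-- A nontrivial normal subgroup is the preimage of a normal subgroup of `S₆`, which is `1`, `A₆` or
`S₆`. -/
theorem normal_eq {N : Subgroup G} [hN : N.Normal] (hbot : N ≠ ⊥) :
    N = hΨ.perm.ker ∨ N = hΨ.sgn.ker ∨ N = ⊤ := by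
  have hle := hΨ.perm_ker_le hbot
  have hN' : (N.map hΨ.perm).comap hΨ.perm = N := Subgroup.comap_map_eq_self hle
  have hnorm : (N.map hΨ.perm).Normal := hN.map _ hΨ.perm_surjective
  by_cases hb : N.map hΨ.perm = ⊥
  · left
    rw [← hN', hb]; rfl
  right
  have hA : alternatingGroup (Fin 6) ≤ N.map hΨ.perm := by
    refine Perm.alternatingGroup_le_of_normal (by simp) ?_
    exact (Subgroup.nontrivial_iff_ne_bot _).2 hb
  have hA' : hΨ.sgn.ker ≤ N := by
    rw [← hN']
    exact fun x hx => hA (Perm.mem_alternatingGroup.2 hx)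
  by_cases hNs : N ≤ hΨ.sgn.ker
  · exact Or.inl (le_antisymm hNs hA')
  right
  obtain ⟨y, hyN, hy⟩ := SetLike.not_le_iff_exists.1 hNs
  have hy : hΨ.sgn y = -1 := (Int.units_eq_one_or _).resolve_left hy
  rw [eq_top_iff]
  intro x _
  rcases Int.units_eq_one_or (hΨ.sgn x) with hx | hx
  · exact hA' hx
  · have : x * y⁻¹ ∈ N := hA' (by rw [MonoidHom.mem_ker, map_mul, map_inv, hx, hy]; decide)
    simpa using N.mul_mem this hyN

theorem commutator_eq : commutator G = hΨ.sgn.ker := by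
  have hle : commutator G ≤ hΨ.sgn.ker := Abelianization.commutator_subset_ker _
  have hnot : ¬ commutator G ≤ hΨ.perm.ker := by
    intro h
    obtain ⟨x, hx⟩ := hΨ.perm_surjective (swap 0 1)
    obtain ⟨y, hy⟩ := hΨ.perm_surjective (swap 1 2)
    have hmem := h (Subgroup.commutator_mem_commutator (Subgroup.mem_top x) (Subgroup.mem_top y))
    rw [MonoidHom.mem_ker, map_commutatorElement, hx, hy, commutatorElement_def] at hmem
    exact absurd hmem (by decide)
  rcases hΨ.normal_eq (N := commutator G) (fun h => hnot (h ▸ bot_le)) with h | h | h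
  · exact absurd h.le hnot
  · exact h
  · obtain ⟨x, hx⟩ := hΨ.perm_surjective (swap 0 1)
    have : x ∈ hΨ.sgn.ker := hle (h ▸ Subgroup.mem_top x)
    rw [MonoidHom.mem_ker, sgn_apply, hx] at this
    exact absurd this (by decide)

theorem normal_iff (N : Subgroup G) :
    (N.Normal ∧ N ≠ ⊥ ∧ N ≠ ⊤) ↔ (N = hΨ.perm.ker ∨ N = commutator G) := by
  have hG := hΨ.finite
  rw [hΨ.commutator_eq]
  constructor
  · rintro ⟨_, hbot, htop⟩
    rcases hΨ.normal_eq hbot with h | h | h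
    exacts [Or.inl h, Or.inr h, absurd h htop]
  · have key : ∀ M : Subgroup G, Nat.card M ≠ 1 → Nat.card M ≠ 11520 → M ≠ ⊥ ∧ M ≠ ⊤ := by
      refine fun M h1 h2 => ⟨?_, ?_⟩
      · rintro rfl; exact h1 Subgroup.card_bot
      · rintro rfl; exact h2 (Subgroup.card_top.trans hΨ.card_eq)
    rintro (rfl | rfl)
    · exact ⟨inferInstance, key _ (by rw [hΨ.card_perm_ker]; decide)
        (by rw [hΨ.card_perm_ker]; decide)⟩
    · exact ⟨inferInstance, key _ (by rw [hΨ.card_sgn_ker]; decide)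
        (by rw [hΨ.card_sgn_ker]; decide)⟩

theorem linear_character_eq (χ : G →* ℂˣ) : χ = 1 ∨ χ = signToLinear hΨ.sgn := by
  have hker : ∀ x, hΨ.sgn x = 1 → χ x = 1 := by
    intro x hx
    have : x ∈ commutator G := by rw [hΨ.commutator_eq]; exact hx
    exact Abelianization.commutator_subset_ker χ this
  obtain ⟨t, ht⟩ := hΨ.perm_surjective (swap 0 1)
  have ht' : hΨ.sgn t = -1 := by rw [sgn_apply, ht]; decide
  have hodd : ∀ x, hΨ.sgn x = -1 → χ x = χ t := by
    intro x hx
    have := hker (x * t⁻¹) (by rw [map_mul, map_inv, hx, ht']; decide)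
    rwa [map_mul, map_inv, mul_inv_eq_one] at this
  have hsq : χ t * χ t = 1 := by
    rw [← map_mul]; exact hker _ (by rw [map_mul, ht']; decide)
  have hsq' : χ t = 1 ∨ χ t = -1 := by
    have h : ((χ t : ℂ)) * χ t = 1 := congrArg Units.val hsq
    rcases mul_self_eq_one_iff.1 h with h | h
    · exact Or.inl (Units.ext h)
    · exact Or.inr (Units.ext h)
  refine hsq'.imp (fun h => ?_) fun h => ?_ <;> ext1 x <;>
    rcases Int.units_eq_one_or (hΨ.sgn x) with hx | hx
  · rw [hker x hx]; rfl
  · rw [hodd x hx, h]; rfl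
  · rw [hker x hx]; simp [signToLinear, hx]
  · rw [hodd x hx, h]; ext; simp [signToLinear, hx]

end IsCover
end SignedPerm

/-- A one-dimensional representation acts through a linear character. -/
theorem representation_eq_smul {G : Type*} [Group G] {V : Type*} [AddCommGroup V] [Module ℂ V]
    (ρ : Representation ℂ G V) (hV : Module.finrank ℂ V = 1) :
    ∃ χ : G →* ℂˣ, ∀ g v, ρ g v = (χ g : ℂ) • v := by
  obtain ⟨v₀, hv₀, hspan⟩ := finrank_eq_one_iff'.1 hV
  choose c hc using fun g => hspan (ρ g v₀)
  have hρ : ∀ g v, ρ g v = c g • v := by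
    intro g v
    obtain ⟨d, rfl⟩ := hspan v
    rw [map_smul, ← hc, smul_comm]
  have hinj : ∀ x y : ℂ, x • v₀ = y • v₀ → x = y := fun x y h => smul_left_injective ℂ hv₀ h
  let f : G →* ℂ :=
    { toFun := c
      map_one' := hinj _ _ (by rw [← hρ, map_one, one_smul]; rfl)
      map_mul' := fun g h => hinj _ _ (by rw [← hρ, map_mul, mul_smul, ← hρ, ← hρ]; rfl) }
  exact ⟨f.toHomUnits, fun g v => hρ g v⟩

/-! ### The conjugacy classes -/

namespace SignedPerm

/-- A permutation of each cycle type. -/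
def cycleRep : Fin 11 → Perm (Fin 6) :=
  ![1, c[0, 1], c[0, 1] * c[2, 3], c[0, 1] * c[2, 3] * c[4, 5], c[0, 1, 2], c[0, 1, 2] * c[3, 4],
    c[0, 1, 2] * c[3, 4, 5], c[0, 1, 2, 3], c[0, 1, 2, 3] * c[4, 5], c[0, 1, 2, 3, 4],
    c[0, 1, 2, 3, 4, 5]]

/-- The partitions of `6`, without their parts equal to `1`. -/
def cycleTypes : Fin 11 → Multiset ℕ :=
  ![0, {2}, {2, 2}, {2, 2, 2}, {3}, {3, 2}, {3, 3}, {4}, {4, 2}, {5}, {6}]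

theorem cycleType_cycleRep : ∀ i, (cycleRep i).cycleType = cycleTypes i := by
  decide +kernel

theorem cycleTypes_injective : Function.Injective cycleTypes := by
  unfold Function.Injective; decide +kernel

theorem exists_eq_cycleTypes (m : Multiset ℕ) (h2 : ∀ a ∈ m, 2 ≤ a) (hm : m.sum ≤ 6) :
    ∃ i, m = cycleTypes i := by
  rcases m.empty_or_exists_mem with rfl | ⟨a, ha⟩
  · exact ⟨0, rfl⟩
  obtain ⟨m, rfl⟩ := Multiset.exists_cons_of_mem ha
  have ha2 := h2 a ha
  rw [Multiset.sum_cons] at hm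
  rcases m.empty_or_exists_mem with rfl | ⟨b, hb⟩
  · have : a ≤ 6 := by simpa using hm
    interval_cases a <;> decide
  obtain ⟨m, rfl⟩ := Multiset.exists_cons_of_mem hb
  have hb2 := h2 b (Multiset.mem_cons_of_mem hb)
  rw [Multiset.sum_cons] at hm
  rcases m.empty_or_exists_mem with rfl | ⟨c, hc⟩
  · have : a + b ≤ 6 := by simpa using hm
    have ha4 : a ≤ 4 := by omega
    have hb4 : b ≤ 4 := by omega
    interval_cases a <;> interval_cases b <;> first | omega | decide
  obtain ⟨m, rfl⟩ := Multiset.exists_cons_of_mem hc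
  have hc2 := h2 c (Multiset.mem_cons_of_mem (Multiset.mem_cons_of_mem hc))
  rw [Multiset.sum_cons] at hm
  rcases m.empty_or_exists_mem with rfl | ⟨d, hd⟩
  · obtain ⟨rfl, rfl, rfl⟩ : a = 2 ∧ b = 2 ∧ c = 2 := by
      rw [Multiset.sum_zero] at hm
      omega
    exact ⟨3, rfl⟩
  · have hd2 := h2 d (Multiset.mem_cons_of_mem (Multiset.mem_cons_of_mem
      (Multiset.mem_cons_of_mem hd)))
    have := Multiset.le_sum_of_mem hd
    omega

theorem exists_isConj_cycleRep (π : Perm (Fin 6)) : ∃ i, IsConj π (cycleRep i) := by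
  obtain ⟨i, hi⟩ := exists_eq_cycleTypes π.cycleType (fun _ => Perm.two_le_of_mem_cycleType)
    (by rw [Perm.sum_cycleType]; exact Finset.card_le_univ π.support)
  exact ⟨i, Perm.isConj_iff_cycleType_eq.2 (hi.trans (cycleType_cycleRep i).symm)⟩

/-- The sign vector with `-1` at the positions of the nonzero binary digits of `m`. Sign vectors are
encoded in this way because the kernel computes fast with numerals. -/
def maskSign (m : ℕ) (a : Fin 6) : ℤˣ := if m.testBit a then -1 else 1

theorem exists_eq_maskSign : ∀ l : Fin 6 → ℤˣ, ∃ m ∈ List.range 64, l = maskSign m := by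
  decide +kernel

theorem maskSign_xor (m n : ℕ) (a : Fin 6) :
    maskSign (m ^^^ n) a = maskSign m a * maskSign n a := by
  simp only [maskSign, Nat.testBit_xor]
  cases m.testBit a <;> cases n.testBit a <;> rfl

/-- Whether the number of minus signs of `maskSign m` is odd. -/
def maskParity (m : ℕ) : Bool :=
  m.testBit 0 ^^ m.testBit 1 ^^ m.testBit 2 ^^ m.testBit 3 ^^ m.testBit 4 ^^ m.testBit 5

theorem prod_maskSign (m : ℕ) : ∏ a, maskSign m a = if maskParity m then -1 else 1 := by
  have key : ∀ x₀ x₁ x₂ x₃ x₄ x₅ : Bool,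
      ((((((if x₀ then -1 else 1) * if x₁ then -1 else 1) * if x₂ then -1 else 1) *
        if x₃ then -1 else 1) * if x₄ then -1 else 1) * if x₅ then -1 else 1 : ℤˣ) =
      if x₀ ^^ x₁ ^^ x₂ ^^ x₃ ^^ x₄ ^^ x₅ then -1 else 1 := by decide
  rw [Fin.prod_univ_six]
  exact key _ _ _ _ _ _

/-- The cycle type, as an index into `cycleRep`, of each of the 21 class representatives. -/
def classCycle : Fin 21 → Fin 11 :=
  ![0, 0, 1, 1, 1, 2, 2, 2, 3, 3, 4, 4, 5, 5, 6, 7, 7, 8, 8, 9, 10]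

/-- The signs, as a mask, of each of the 21 class representatives. -/
def classMask : Fin 21 → ℕ :=
  ![0, 48, 32, 2, 50, 0, 40, 10, 32, 42, 0, 48, 32, 16, 0, 32, 8, 0, 40, 0, 32]

/-- Representatives of the 21 classes of the signed permutations of determinant one modulo `±1`. -/
def classRep (k : Fin 21) : SignedPerm := ⟨maskSign (classMask k), cycleRep (classCycle k)⟩

theorem det_classRep : ∀ k, det (classRep k) = 1 := by
  decide +kernel

/-- The representatives are separated by three class functions that ignore `±1`: the cycle type, the
square of the trace, and the trace of the square. -/
theorem eq_of_trace_eq : ∀ j k, classCycle j = classCycle k →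
    trace (classRep j) ^ 2 = trace (classRep k) ^ 2 →
    trace (classRep j * classRep j) = trace (classRep k * classRep k) → j = k := by
  decide +kernel

/-- The values of `(cycleRep i)⁻¹`, as numerals. -/
def cycleTable (i : Fin 11) : List ℕ :=
  [[0, 1, 2, 3, 4, 5], [1, 0, 2, 3, 4, 5], [1, 0, 3, 2, 4, 5], [1, 0, 3, 2, 5, 4],
    [2, 0, 1, 3, 4, 5], [2, 0, 1, 4, 3, 5], [2, 0, 1, 5, 3, 4], [3, 0, 1, 2, 4, 5],
    [3, 0, 1, 2, 5, 4], [4, 0, 1, 2, 3, 5], [5, 0, 1, 2, 3, 4]].getD i []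

theorem cycleTable_eq : ∀ i, ∀ a : Fin 6,
    (((cycleRep i)⁻¹ a : Fin 6) : ℕ) = (cycleTable i).getD a 0 := by
  decide +kernel

/-- Whether `cycleRep i` is odd. -/
def cycleParity (i : Fin 11) : Bool :=
  [false, true, false, true, false, true, false, true, false, false, true].getD i false

theorem sign_cycleRep : ∀ i, Perm.sign (cycleRep i) = if cycleParity i then -1 else 1 := by
  decide +kernel

/-- Permutations that commute with `cycleRep i`. Together with the diagonal matrices, those listed
are enough to conjugate every sign vector over `cycleRep i` to one of the representatives. -/
def centralizing : Fin 11 → List (Perm (Fin 6)) :=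
  ![[1, c[3, 4], c[3, 5], c[2, 4], c[2, 5], c[1, 4], c[1, 5], c[0, 4], c[0, 5], c[2, 4] * c[3, 5],
      c[1, 4] * c[3, 5], c[1, 4] * c[2, 5], c[0, 4] * c[3, 5], c[0, 4] * c[2, 5],
      c[0, 4] * c[1, 5]],
    [1, c[3, 5], c[2, 5], c[4, 5]], [1, c[0, 2] * c[1, 3]],
    [1, c[2, 4] * c[3, 5], c[0, 4] * c[1, 5]], [1, c[3, 4], c[3, 5]],
    [1], [1], [1], [1], [1], [1]]

theorem centralizing_comm : ∀ i, ∀ π ∈ centralizing i,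
    ∀ a, π (cycleRep i a) = cycleRep i (π a) := by
  decide +kernel

/-- For each permutation in `centralizing i`, whether it is odd and the values of its inverse. -/
def centralizingTable (i : Fin 11) : List (Bool × List ℕ) :=
  [[(false, [0, 1, 2, 3, 4, 5]), (true, [0, 1, 2, 4, 3, 5]), (true, [0, 1, 2, 5, 4, 3]),
      (true, [0, 1, 4, 3, 2, 5]), (true, [0, 1, 5, 3, 4, 2]), (true, [0, 4, 2, 3, 1, 5]),
      (true, [0, 5, 2, 3, 4, 1]), (true, [4, 1, 2, 3, 0, 5]), (true, [5, 1, 2, 3, 4, 0]),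
      (false, [0, 1, 4, 5, 2, 3]), (false, [0, 4, 2, 5, 1, 3]), (false, [0, 4, 5, 3, 1, 2]),
      (false, [4, 1, 2, 5, 0, 3]), (false, [4, 1, 5, 3, 0, 2]), (false, [4, 5, 2, 3, 0, 1])],
    [(false, [0, 1, 2, 3, 4, 5]), (true, [0, 1, 2, 5, 4, 3]), (true, [0, 1, 5, 3, 4, 2]),
      (true, [0, 1, 2, 3, 5, 4])],
    [(false, [0, 1, 2, 3, 4, 5]), (false, [2, 3, 0, 1, 4, 5])],
    [(false, [0, 1, 2, 3, 4, 5]), (false, [0, 1, 4, 5, 2, 3]), (false, [4, 5, 2, 3, 0, 1])],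
    [(false, [0, 1, 2, 3, 4, 5]), (true, [0, 1, 2, 4, 3, 5]), (true, [0, 1, 2, 5, 4, 3])],
    [(false, [0, 1, 2, 3, 4, 5])], [(false, [0, 1, 2, 3, 4, 5])], [(false, [0, 1, 2, 3, 4, 5])],
    [(false, [0, 1, 2, 3, 4, 5])], [(false, [0, 1, 2, 3, 4, 5])],
    [(false, [0, 1, 2, 3, 4, 5])]].getD i []

theorem centralizingTable_eq : ∀ i, ∀ t ∈ centralizingTable i, ∃ π ∈ centralizing i,
    Perm.sign π = (if t.1 then -1 else 1) ∧
      ∀ a : Fin 6, ((π⁻¹ a : Fin 6) : ℕ) = t.2.getD a 0 := by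
  decide +kernel

/-- The mask whose bits are those of `m` at the listed positions. -/
def permMask (m : ℕ) : List ℕ → ℕ
  | [] => 0
  | a :: l => ((m >>> a) &&& 1) + 2 * permMask m l

theorem testBit_permMask (m : ℕ) (l : List ℕ) (a : ℕ) (ha : a < l.length) :
    (permMask m l).testBit a = m.testBit (l.getD a 0) := by
  induction l generalizing a with
  | nil => exact absurd ha (Nat.not_lt_zero a)
  | cons b l ih =>
    have hb : (m >>> b) &&& 1 = (m.testBit b).toNat := by
      rw [Nat.testBit_eq_decide_div_mod_eq, Nat.and_one_is_mod, Nat.shiftRight_eq_div_pow]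
      rcases Nat.mod_two_eq_zero_or_one (m / 2 ^ b) with h | h <;> simp [h]
    have hlt : (m.testBit b).toNat < 2 := Bool.toNat_lt _
    cases a with
    | zero =>
      rw [permMask, hb, Nat.testBit_zero]
      cases h : m.testBit b <;> simp [h]
    | succ a =>
      rw [permMask, hb, Nat.testBit_succ, Nat.add_mul_div_left _ _ two_pos,
        Nat.div_eq_of_lt hlt, zero_add, ih a (Nat.lt_of_succ_lt_succ ha)]
      simp

theorem maskSign_permMask (m : ℕ) {l : List ℕ} (hl : l.length = 6) {a b : Fin 6}
    (h : (b : ℕ) = l.getD a 0) : maskSign (permMask m l) a = maskSign m b := by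
  rw [maskSign, maskSign, testBit_permMask m l a (by rw [hl]; exact a.2), h]

theorem maskSign_xor_all (m : ℕ) (a : Fin 6) : maskSign (m ^^^ 63) a = -maskSign m a := by
  rw [maskSign_xor, (by revert a; decide : maskSign 63 a = -1), mul_neg_one]

theorem length_cycleTable : ∀ i, (cycleTable i).length = 6 := by
  decide +kernel

theorem length_centralizingTable : ∀ i, ∀ t ∈ centralizingTable i, t.2.length = 6 := by
  decide +kernel

/-- With `p` and `t` the values of `σ⁻¹` and `π⁻¹` for commuting permutations `σ` and `π`, this says
that `⟨maskSign d, π⟩` conjugates `⟨maskSign s, σ⟩` to `⟨maskSign r, σ⟩`. -/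
def isConjMask (p t : List ℕ) (s r d : ℕ) : Bool :=
  d ^^^ permMask s t == r ^^^ permMask d p

/-- The masks of the representatives over `cycleRep i`. -/
def classMasks (i : Fin 11) : List ℕ :=
  [[0, 48], [32, 2, 50], [0, 40, 10], [32, 42], [0, 48], [32, 16], [0], [32, 8], [0, 40], [0],
    [32]].getD i []

theorem exists_classMask : ∀ i, ∀ r ∈ classMasks i, ∃ k, classCycle k = i ∧ classMask k = r := by
  decide +kernel

/-- The masks of given parity. -/
def masks (b : Bool) : List ℕ := (List.range 64).filter (maskParity · == b)

/-- Every sign vector `s` for which `⟨maskSign s, cycleRep i⟩` has determinant one is conjugate, by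
an element of determinant one and up to the sign `-1` (the mask `63`), to that of a
representative. -/
theorem exists_isConjMask : ∀ i, (masks (cycleParity i)).all (fun s =>
    (classMasks i).any fun r => (centralizingTable i).any fun t => (masks t.1).any fun d =>
      isConjMask (cycleTable i) t.2 s r d ||
        isConjMask (cycleTable i) t.2 s (r ^^^ 63) d) = true := by
  decide +kernel

theorem exists_conj_eq_classRep {g : SignedPerm} {i : Fin 11} (hg : det g = 1)
    (hi : g.right = cycleRep i) : ∃ k, ∃ h : SignedPerm, det h = 1 ∧
      (h * g = classRep k * h ∨ h * g = negOne * (classRep k * h)) := by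
  obtain ⟨l, p⟩ := g
  obtain rfl : p = cycleRep i := hi
  obtain ⟨s, hs, rfl⟩ := exists_eq_maskSign l
  have hpar : maskParity s = cycleParity i := by
    rw [det_apply, prod_maskSign, sign_cycleRep] at hg
    revert hg
    cases maskParity s <;> cases cycleParity i <;> decide
  have key := List.all_eq_true.1 (exists_isConjMask i) s
    (List.mem_filter.2 ⟨hs, by rw [hpar]; exact beq_self_eq_true _⟩)
  simp only [List.any_eq_true, Bool.or_eq_true, isConjMask, beq_iff_eq] at key
  obtain ⟨r, hr, t, ht, d, hd, key⟩ := key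
  obtain ⟨k, rfl, rfl⟩ := exists_classMask i r hr
  obtain ⟨π, hπ, hsign, htab⟩ := centralizingTable_eq _ t ht
  have hbit : ∀ {m n : ℕ}, m = n → ∀ a, maskSign m a = maskSign n a := fun h a => by rw [h]
  have hright : π * cycleRep (classCycle k) = cycleRep (classCycle k) * π :=
    Equiv.ext fun a => centralizing_comm _ π hπ a
  refine ⟨k, ⟨maskSign d, π⟩, ?_, key.imp (fun h => ?_) fun h => ?_⟩
  · rw [det_apply, prod_maskSign, hsign, beq_iff_eq.1 (List.mem_filter.1 hd).2]
    cases t.1 <;> rfl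
  · refine SemidirectProduct.ext (funext fun a => ?_) hright
    have := hbit h a
    rwa [maskSign_xor, maskSign_xor, maskSign_permMask s (length_centralizingTable _ t ht) (htab a),
      maskSign_permMask d (length_cycleTable _) (cycleTable_eq _ a)] at this
  · refine SemidirectProduct.ext (funext fun a => ?_) ((negOne_mul_right _).trans hright.symm).symm
    have := hbit h a
    rw [maskSign_xor, maskSign_xor, maskSign_permMask s (length_centralizingTable _ t ht) (htab a),
      maskSign_permMask d (length_cycleTable _) (cycleTable_eq _ a), maskSign_xor_all,
      neg_mul] at this
    rw [negOne_mul_left]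
    exact this

namespace IsCover

variable {G : Type*} [Group G] {Ψ : det.ker →* G} (hΨ : IsCover Ψ)
include hΨ

theorem isConj_iff_exists {g h : det.ker} : IsConj (Ψ g) (Ψ h) ↔
    ∃ c : SignedPerm, det c = 1 ∧ (c * g.1 = h.1 * c ∨ c * g.1 = negOne * (h.1 * c)) := by
  rw [isConj_iff]
  constructor
  · rintro ⟨x, hx⟩
    obtain ⟨c, rfl⟩ := hΨ.surjective x
    rw [mul_inv_eq_iff_eq_mul, ← map_mul, ← map_mul, hΨ.eq_iff] at hx
    exact ⟨c.1, c.2, hx⟩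
  · rintro ⟨c, hc, h'⟩
    refine ⟨Ψ ⟨c, hc⟩, ?_⟩
    rw [mul_inv_eq_iff_eq_mul, ← map_mul, ← map_mul, hΨ.eq_iff]
    exact h'

theorem card_conjClasses : Nat.card (ConjClasses G) = 21 := by
  let f : Fin 21 → ConjClasses G := fun k => ConjClasses.mk (Ψ ⟨classRep k, det_classRep k⟩)
  have hinj : Function.Injective f := by
    intro j k hjk
    obtain ⟨c, -, hc⟩ := hΨ.isConj_iff_exists.1 (ConjClasses.mk_eq_mk_iff_isConj.1 hjk)
    replace hc : c * classRep j * c⁻¹ = classRep k ∨ c * classRep j * c⁻¹ = negOne * classRep k :=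
      hc.imp (fun h => by rw [mul_inv_eq_iff_eq_mul, h])
        fun h => by rw [mul_inv_eq_iff_eq_mul, h, mul_assoc]
    have hcyc : classCycle j = classCycle k := by
      refine cycleTypes_injective ?_
      rw [← cycleType_cycleRep, ← cycleType_cycleRep, ← Perm.isConj_iff_cycleType_eq, isConj_iff]
      refine ⟨c.right, ?_⟩
      rcases hc with h | h
      · exact congrArg SemidirectProduct.right h
      · have := congrArg SemidirectProduct.right h
        rwa [negOne_mul_right] at this
    refine eq_of_trace_eq j k hcyc ?_ ?_
    · rw [← trace_conj (classRep j) c]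
      rcases hc with h | h <;> rw [h]
      rw [trace_negOne_mul, neg_sq]
    · rw [← trace_conj _ c]
      congr 1
      have e : c * (classRep j * classRep j) * c⁻¹ =
        (c * classRep j * c⁻¹) * (c * classRep j * c⁻¹) := by group
      rw [e]
      rcases hc with h | h <;> rw [h]
      rw [mul_assoc, ← mul_assoc (classRep k) negOne, ← negOne_mul_comm, mul_assoc negOne,
        ← mul_assoc, negOne_mul_negOne, one_mul]
  have hsurj : Function.Surjective f := by
    intro x
    obtain ⟨y, rfl⟩ := ConjClasses.exists_rep x
    obtain ⟨g, rfl⟩ := hΨ.surjective y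
    obtain ⟨i, hi⟩ := exists_isConj_cycleRep g.1.right
    obtain ⟨π, hπ⟩ := isConj_iff.1 hi
    obtain ⟨b, hb, rfl⟩ := exists_det_eq_one π
    obtain ⟨k, c, hc, h⟩ := exists_conj_eq_classRep (g := b * g.1 * b⁻¹) (i := i)
      (by rw [map_mul, map_mul, map_inv, show det g.1 = 1 from g.2]; simp) hπ
    refine ⟨k, ConjClasses.mk_eq_mk_iff_isConj.2 (IsConj.symm ?_)⟩
    have e : c * b * g.1 = c * (b * g.1 * b⁻¹) * b := by group
    refine hΨ.isConj_iff_exists.2 ⟨c * b, by rw [map_mul, hc, hb, one_mul], ?_⟩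
    rw [e]
    exact h.imp (fun h => by rw [h, mul_assoc]) fun h => by rw [h, mul_assoc, mul_assoc]
  rw [← Nat.card_congr (Equiv.ofBijective f ⟨hinj, hsurj⟩), Nat.card_eq_fintype_card,
    Fintype.card_fin]

end IsCover

end SignedPerm

/-! ### Pauli matrices over the Gaussian integers -/

open Matrix

/-- The matrices on `R² ⊗ R²`, with basis indexed by pairs. -/
abbrev TwoQubitMatrix (R : Type) := Matrix (Fin 2 × Fin 2) (Fin 2 × Fin 2) R

/-- Gaussian-integer matrices as complex matrices. Identities between Pauli matrices and gates are
checked over the Gaussian integers, where equality is decidable. -/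
def toC : TwoQubitMatrix GaussianInt →+* TwoQubitMatrix ℂ := GaussianInt.toComplex.mapMatrix

theorem toC_apply (M : TwoQubitMatrix GaussianInt) (i j) :
    toC M i j = GaussianInt.toComplex (M i j) := rfl

theorem toC_injective : Function.Injective toC := fun _ _ h =>
  Matrix.ext fun i j => GaussianInt.toComplex_injective (congrFun (congrFun h i) j)

theorem toC_smul (c : GaussianInt) (M : TwoQubitMatrix GaussianInt) :
    toC (c • M) = GaussianInt.toComplex c • toC M := by
  ext i j
  simp [toC_apply]

theorem toC_transpose (M : TwoQubitMatrix GaussianInt) : toC Mᵀ = (toC M)ᵀ := rfl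

theorem toC_conjTranspose (M : TwoQubitMatrix GaussianInt) : toC Mᴴ = (toC M)ᴴ := by
  ext i j
  simp [toC_apply, conjTranspose_apply, GaussianInt.toComplex_star]

theorem trace_toC (M : TwoQubitMatrix GaussianInt) :
    (toC M).trace = GaussianInt.toComplex M.trace := by
  simp [Matrix.trace, toC_apply]

/-- The imaginary unit as a Gaussian integer. -/
def gaussI : GaussianInt := ⟨0, 1⟩

theorem toComplex_gaussI : GaussianInt.toComplex gaussI = Complex.I := by
  simp [gaussI, GaussianInt.toComplex_def]

/-- The Pauli matrices `I, X, Y, Z`, in this order, over the Gaussian integers. -/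
def sigma : Fin 4 → Matrix (Fin 2) (Fin 2) GaussianInt :=
  ![!![1, 0; 0, 1], !![0, 1; 1, 0], !![0, -gaussI; gaussI, 0], !![1, 0; 0, -1]]

/-- The two-qubit Pauli matrices over the Gaussian integers. -/
def gaussPauli (a b : Fin 4) : TwoQubitMatrix GaussianInt := sigma a ⊗ₖ sigma b

/-- The Pauli matrices `I, X, Y, Z`, in this order, as unitary matrices. -/
def sigmaU : Fin 4 → U2 := ![1, pauliX, pauliY, pauliZ]

/-- The two-qubit Pauli matrices as unitary matrices. -/
def pauli (a b : Fin 4) : U4 := tensor (sigmaU a) (sigmaU b)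

theorem coe_sigmaU (a : Fin 4) :
    (sigmaU a : Matrix (Fin 2) (Fin 2) ℂ) = (sigma a).map GaussianInt.toComplex := by
  fin_cases a <;> ext i j <;> fin_cases i <;> fin_cases j <;>
    simp [sigmaU, sigma, pauliX, pauliY, pauliZ, toComplex_gaussI]

theorem toC_kronecker (M N : Matrix (Fin 2) (Fin 2) GaussianInt) :
    toC (M ⊗ₖ N) = M.map GaussianInt.toComplex ⊗ₖ N.map GaussianInt.toComplex := by
  ext i j
  simp [toC_apply]

theorem coe_pauli (a b : Fin 4) : (pauli a b : TwoQubitMatrix ℂ) = toC (gaussPauli a b) := by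
  rw [gaussPauli, toC_kronecker, ← coe_sigmaU, ← coe_sigmaU]
  rfl

/-- The units of the Gaussian integers. -/
def phaseUnits : List GaussianInt := [1, -1, gaussI, -gaussI]

theorem toComplex_ne_zero_of_mem {c : GaussianInt} (hc : c ∈ phaseUnits) :
    GaussianInt.toComplex c ≠ 0 := by
  rw [Ne, GaussianInt.toComplex_eq_zero]
  rintro rfl
  exact absurd hc (by decide)

theorem sigma_mul_sigma : ∀ a b, ∃ c ∈ phaseUnits, ∃ d, sigma a * sigma b = c • sigma d := by
  decide +kernel

theorem pauli_mul_pauli (a b a' b' : Fin 4) : ∃ c : ℂ, c ≠ 0 ∧ ∃ d d',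
    (pauli a b : TwoQubitMatrix ℂ) * pauli a' b' = c • (pauli d d' : TwoQubitMatrix ℂ) := by
  obtain ⟨c, hc, d, h⟩ := sigma_mul_sigma a a'
  obtain ⟨c', hc', d', h'⟩ := sigma_mul_sigma b b'
  refine ⟨GaussianInt.toComplex (c * c'), ?_, d, d', ?_⟩
  · rw [map_mul]
    exact mul_ne_zero (toComplex_ne_zero_of_mem hc) (toComplex_ne_zero_of_mem hc')
  · simp only [coe_pauli]
    rw [← map_mul, ← toC_smul, gaussPauli, gaussPauli, ← mul_kronecker_mul, h, h', smul_kronecker,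
      kronecker_smul, smul_smul, gaussPauli]

theorem pauli_mul_self (a b : Fin 4) : (pauli a b : TwoQubitMatrix ℂ) * pauli a b = 1 := by
  rw [coe_pauli, ← map_mul, ← map_one toC]
  congr 1
  revert a b
  decide +kernel

theorem star_pauli (a b : Fin 4) : star (pauli a b : TwoQubitMatrix ℂ) = pauli a b := by
  rw [coe_pauli, star_eq_conjTranspose, ← toC_conjTranspose]
  congr 1
  revert a b
  decide +kernel

theorem transpose_pauli (a b : Fin 4) : ∃ c : ℂ, c ≠ 0 ∧
    (pauli a b : TwoQubitMatrix ℂ)ᵀ = c • (pauli a b : TwoQubitMatrix ℂ) := by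
  have : ∀ a b, ∃ c ∈ phaseUnits, (gaussPauli a b)ᵀ = c • gaussPauli a b := by
    decide +kernel
  obtain ⟨c, hc, h⟩ := this a b
  exact ⟨_, toComplex_ne_zero_of_mem hc, by rw [coe_pauli, ← toC_transpose, h, toC_smul]⟩

theorem mem_pauliMatrices_iff {s : U2} : s ∈ pauliMatrices ↔ ∃ a, s = sigmaU a := by
  constructor
  · rintro (rfl | rfl | rfl | rfl)
    exacts [⟨0, rfl⟩, ⟨1, rfl⟩, ⟨2, rfl⟩, ⟨3, rfl⟩]
  · rintro ⟨a, rfl⟩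
    fin_cases a
    exacts [one_mem_pauliMatrices, pauliX_mem, pauliY_mem, pauliZ_mem]

theorem pauli_mem (a b : Fin 4) : pauli a b ∈ phasedPauli :=
  Subgroup.subset_closure ⟨_, mem_pauliMatrices_iff.2 ⟨a, rfl⟩, _, mem_pauliMatrices_iff.2 ⟨b, rfl⟩,
    rfl⟩

theorem coe_mul_star (U : U4) : (U : TwoQubitMatrix ℂ) * star (U : TwoQubitMatrix ℂ) = 1 :=
  Unitary.coe_mul_star_self U

theorem star_mul_coe (U : U4) : star (U : TwoQubitMatrix ℂ) * (U : TwoQubitMatrix ℂ) = 1 :=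
  Unitary.coe_star_mul_self U

theorem coe_inv (U : U4) : ((U⁻¹ : U4) : TwoQubitMatrix ℂ) = star (U : TwoQubitMatrix ℂ) := rfl

theorem coe_ne_zero (U : U4) : (U : TwoQubitMatrix ℂ) ≠ 0 := by
  intro h
  have := coe_mul_star U
  rw [h, zero_mul] at this
  exact zero_ne_one this

theorem ne_zero_of_coe_eq_smul {U : U4} {c : ℂ} {M : TwoQubitMatrix ℂ}
    (h : (U : TwoQubitMatrix ℂ) = c • M) : c ≠ 0 := by
  rintro rfl
  exact coe_ne_zero U (h.trans (zero_smul ℂ M))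

theorem exists_eq_smul_pauli {U : U4} (hU : U ∈ phasedPauli) :
    ∃ c : ℂ, ∃ a b, (U : TwoQubitMatrix ℂ) = c • (pauli a b : TwoQubitMatrix ℂ) := by
  induction hU using Subgroup.closure_induction with
  | mem U hU =>
    obtain ⟨s, hs, t, ht, rfl⟩ := hU
    obtain ⟨a, rfl⟩ := mem_pauliMatrices_iff.1 hs
    obtain ⟨b, rfl⟩ := mem_pauliMatrices_iff.1 ht
    exact ⟨1, a, b, (one_smul _ _).symm⟩
  | one =>
    refine ⟨1, 0, 0, ?_⟩
    rw [one_smul]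
    exact congrArg Subtype.val tensor_one.symm
  | mul U V _ _ hU hV =>
    obtain ⟨c, a, b, hU⟩ := hU
    obtain ⟨c', a', b', hV⟩ := hV
    obtain ⟨c'', -, d, d', h⟩ := pauli_mul_pauli a b a' b'
    refine ⟨c * c' * c'', d, d', ?_⟩
    change (U : TwoQubitMatrix ℂ) * (V : TwoQubitMatrix ℂ) = _
    rw [hU, hV, smul_mul_smul_comm, h, smul_smul]
  | inv U _ hU =>
    obtain ⟨c, a, b, hU⟩ := hU
    refine ⟨star c, a, b, ?_⟩
    rw [coe_inv, hU, star_smul, star_pauli]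

/-! ### Clifford matrices and transposition -/

theorem clifford_mul_pauli {U : U4} (hU : U ∈ phasedClifford) (a b : Fin 4) :
    ∃ c : ℂ, c ≠ 0 ∧ ∃ a' b', (U : TwoQubitMatrix ℂ) * pauli a b =
      c • ((pauli a' b' : TwoQubitMatrix ℂ) * U) := by
  have hmem : U * pauli a b * U⁻¹ ∈ phasedPauli :=
    (Subgroup.mem_normalizer_iff.1 hU _).1 (pauli_mem a b)
  obtain ⟨c, a', b', h⟩ := exists_eq_smul_pauli hmem
  have h' : (U : TwoQubitMatrix ℂ) * pauli a b = c • ((pauli a' b' : TwoQubitMatrix ℂ) * U) := by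
    rw [← smul_mul_assoc, ← h]
    exact congrArg Subtype.val (inv_mul_cancel_right (U * pauli a b) U).symm
  exact ⟨c, ne_zero_of_coe_eq_smul (U := U * pauli a b) h', a', b', h'⟩

theorem pauli_mul_clifford {U : U4} (hU : U ∈ phasedClifford) (a b : Fin 4) :
    ∃ c : ℂ, c ≠ 0 ∧ ∃ a' b', (pauli a b : TwoQubitMatrix ℂ) * U =
      c • ((U : TwoQubitMatrix ℂ) * pauli a' b') := by
  obtain ⟨c, hc, a', b', h⟩ := clifford_mul_pauli (inv_mem hU) a b
  refine ⟨c, hc, a', b', ?_⟩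
  rw [coe_inv] at h
  calc (pauli a b : TwoQubitMatrix ℂ) * U = U * (star (U : TwoQubitMatrix ℂ) * pauli a b) * U := by
        rw [← mul_assoc, coe_mul_star, one_mul]
    _ = _ := by
        rw [h, mul_smul_comm, smul_mul_assoc, mul_assoc, mul_assoc, star_mul_coe, mul_one]

theorem apply_eq_of_comm_diagonal {N : TwoQubitMatrix ℂ} {d : Fin 2 × Fin 2 → GaussianInt}
    (h : N * toC (diagonal d) = toC (diagonal d) * N) {i j : Fin 2 × Fin 2} (hij : d i ≠ d j) :
    N i j = 0 := by
  have hd : toC (diagonal d) = diagonal fun i => GaussianInt.toComplex (d i) :=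
    diagonal_map (map_zero _)
  have := congrFun (congrFun h i) j
  rw [hd, mul_diagonal, diagonal_mul, mul_comm] at this
  by_contra hN
  exact hij (GaussianInt.toComplex_injective (mul_right_cancel₀ hN this).symm)

theorem apply_eq_of_comm_perm {N : TwoQubitMatrix ℂ} {f : Fin 2 × Fin 2 → Fin 2 × Fin 2}
    (hf : Function.Involutive f) {X : TwoQubitMatrix GaussianInt}
    (hX : ∀ i j, X i j = if i = f j then 1 else 0)
    (h : N * toC X = toC X * N) (i j : Fin 2 × Fin 2) : N i (f j) = N (f i) j := by
  have := congrFun (congrFun h i) j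
  rw [Matrix.mul_apply, Matrix.mul_apply, Fintype.sum_eq_single (f j), Fintype.sum_eq_single (f i),
    toC_apply, toC_apply, hX, hX, if_pos rfl, hf, if_pos rfl, map_one, mul_one, one_mul] at this
  · exact this
  · intro k hk
    rw [toC_apply, hX, if_neg (fun h => hk (by rw [h, hf])), map_zero, zero_mul]
  · intro k hk
    rw [toC_apply, hX, if_neg hk, map_zero, mul_zero]

/-- The Pauli matrices `X ⊗ I`, `Z ⊗ I`, `I ⊗ X`, `I ⊗ Z` have trivial joint centralizer: commuting
with the diagonal ones forces a diagonal matrix, and the other two permute its entries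
transitively. -/
theorem exists_eq_smul_one {N : TwoQubitMatrix ℂ}
    (hX₁ : N * pauli 1 0 = pauli 1 0 * N) (hZ₁ : N * pauli 3 0 = pauli 3 0 * N)
    (hX₂ : N * pauli 0 1 = pauli 0 1 * N) (hZ₂ : N * pauli 0 3 = pauli 0 3 * N) :
    ∃ c : ℂ, N = c • 1 := by
  have gX₁ : gaussPauli 1 0 = Matrix.of fun i j => if i = (j.1 + 1, j.2) then 1 else 0 := by
    decide +kernel
  have gX₂ : gaussPauli 0 1 = Matrix.of fun i j => if i = (j.1, j.2 + 1) then 1 else 0 := by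
    decide +kernel
  have i₁ : ∀ j : Fin 2 × Fin 2, (j.1 + 1 + 1, j.2) = j := by decide
  have i₂ : ∀ j : Fin 2 × Fin 2, (j.1, j.2 + 1 + 1) = j := by decide
  have gZ₁ : gaussPauli 3 0 = diagonal fun i => (-1) ^ (i.1 : ℕ) := by decide +kernel
  have gZ₂ : gaussPauli 0 3 = diagonal fun i => (-1) ^ (i.2 : ℕ) := by decide +kernel
  have hne : ∀ i j : Fin 2, i ≠ j → (-1 : GaussianInt) ^ (i : ℕ) ≠ (-1) ^ (j : ℕ) := by decide
  rw [coe_pauli] at hX₁ hX₂ hZ₁ hZ₂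
  rw [gZ₁] at hZ₁
  rw [gZ₂] at hZ₂
  have d₁ : ∀ i j, i.1 ≠ j.1 → N i j = 0 := fun i j h => apply_eq_of_comm_diagonal hZ₁ (hne _ _ h)
  have d₂ : ∀ i j, i.2 ≠ j.2 → N i j = 0 := fun i j h => apply_eq_of_comm_diagonal hZ₂ (hne _ _ h)
  have f₁ := apply_eq_of_comm_perm (f := fun j => (j.1 + 1, j.2)) i₁
    (fun i j => congrFun (congrFun gX₁ i) j) hX₁
  have f₂ := apply_eq_of_comm_perm (f := fun j => (j.1, j.2 + 1)) i₂
    (fun i j => congrFun (congrFun gX₂ i) j) hX₂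
  refine ⟨N (0, 0) (0, 0), ?_⟩
  have e₁ := f₁ (0, 0) (1, 0)
  have e₂ := f₂ (0, 0) (0, 1)
  have e₃ := f₁ (0, 1) (1, 1)
  ext ⟨i, i'⟩ ⟨j, j'⟩
  by_cases h : (i, i') = (j, j')
  · obtain ⟨rfl, rfl⟩ := Prod.mk.inj h
    rw [Matrix.smul_apply, one_apply_eq, smul_eq_mul, mul_one]
    fin_cases i <;> fin_cases i'
    · rfl
    · exact e₂.symm
    · exact e₁.symm
    · exact e₃.symm.trans e₂.symm
  · rw [Matrix.smul_apply, one_apply_ne h, smul_zero]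
    by_cases hi : i = j
    · exact d₂ _ _ fun hi' => h (Prod.ext hi hi')
    · exact d₁ _ _ hi

-- The decidability instance of the existence statement over the Gaussian integers is large.
set_option synthInstance.maxSize 2000 in
/-- A matrix that commutes up to scalars with `X ⊗ I`, `Z ⊗ I`, `I ⊗ X`, `I ⊗ Z` is a multiple of a
Pauli matrix. The scalars are signs, some Pauli matrix realizes the same signs, and multiplying by
it gives a matrix that commutes with the four. -/
theorem exists_eq_smul_pauli_of_comm {V : TwoQubitMatrix ℂ} (hV : V ≠ 0)
    (h : ∀ p ∈ [((1 : Fin 4), (0 : Fin 4)), (3, 0), (0, 1), (0, 3)], ∃ c : ℂ,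
      V * pauli p.1 p.2 = c • ((pauli p.1 p.2 : TwoQubitMatrix ℂ) * V)) :
    ∃ c : ℂ, ∃ a b, V = c • (pauli a b : TwoQubitMatrix ℂ) := by
  have hsign : ∀ p ∈ [((1 : Fin 4), (0 : Fin 4)), (3, 0), (0, 1), (0, 3)], ∃ u : ℤˣ,
      V * pauli p.1 p.2 = ((u : ℤ) : ℂ) • ((pauli p.1 p.2 : TwoQubitMatrix ℂ) * V) := by
    intro p hp
    obtain ⟨c, hc⟩ := h p hp
    have hcc : (c * c) • V = (1 : ℂ) • V := by
      calc (c * c) • V = c • ((pauli p.1 p.2 : TwoQubitMatrix ℂ) * (c • (pauli p.1 p.2 * V))) := by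
            rw [mul_smul_comm, ← mul_assoc, pauli_mul_self, one_mul, smul_smul]
        _ = V * pauli p.1 p.2 * pauli p.1 p.2 := by rw [← hc, ← mul_assoc, ← smul_mul_assoc, ← hc]
        _ = (1 : ℂ) • V := by rw [mul_assoc, pauli_mul_self, mul_one, one_smul]
    rcases mul_self_eq_one_iff.1 (smul_left_injective ℂ hV hcc) with rfl | rfl
    · exact ⟨1, by simpa using hc⟩
    · exact ⟨-1, by simpa using hc⟩
  obtain ⟨u₁, h₁⟩ := hsign (1, 0) (by decide)
  obtain ⟨u₂, h₂⟩ := hsign (3, 0) (by decide)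
  obtain ⟨u₃, h₃⟩ := hsign (0, 1) (by decide)
  obtain ⟨u₄, h₄⟩ := hsign (0, 3) (by decide)
  have hex : ∀ u₁ u₂ u₃ u₄ : ℤˣ, ∃ a b,
      gaussPauli a b * gaussPauli 1 0 =
        ((u₁ : ℤ) : GaussianInt) • (gaussPauli 1 0 * gaussPauli a b) ∧
      gaussPauli a b * gaussPauli 3 0 =
        ((u₂ : ℤ) : GaussianInt) • (gaussPauli 3 0 * gaussPauli a b) ∧
      gaussPauli a b * gaussPauli 0 1 =
        ((u₃ : ℤ) : GaussianInt) • (gaussPauli 0 1 * gaussPauli a b) ∧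
      gaussPauli a b * gaussPauli 0 3 =
        ((u₄ : ℤ) : GaussianInt) • (gaussPauli 0 3 * gaussPauli a b) := by
    decide +kernel
  obtain ⟨a, b, g₁, g₂, g₃, g₄⟩ := hex u₁ u₂ u₃ u₄
  have key : ∀ (u : ℤˣ) (x y : Fin 4),
      gaussPauli a b * gaussPauli x y =
        ((u : ℤ) : GaussianInt) • (gaussPauli x y * gaussPauli a b) →
      V * pauli x y = ((u : ℤ) : ℂ) • ((pauli x y : TwoQubitMatrix ℂ) * V) →
      (pauli a b : TwoQubitMatrix ℂ) * V * pauli x y = pauli x y * (pauli a b * V) := by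
    intro u x y hg hv
    have hg' : (pauli a b : TwoQubitMatrix ℂ) * pauli x y =
        ((u : ℤ) : ℂ) • ((pauli x y : TwoQubitMatrix ℂ) * pauli a b) := by
      simp only [coe_pauli]
      rw [← map_mul, hg, toC_smul, map_mul, map_intCast]
    have huu : ((u : ℤ) : ℂ) * ((u : ℤ) : ℂ) = 1 := by
      rw [← Int.cast_mul, ← Units.val_mul, Int.units_mul_self]; simp
    rw [mul_assoc, hv, mul_smul_comm, ← mul_assoc, hg', smul_mul_assoc, smul_smul, huu, one_smul,
      mul_assoc]
  obtain ⟨c, hc⟩ := exists_eq_smul_one (key _ _ _ g₁ h₁) (key _ _ _ g₂ h₂) (key _ _ _ g₃ h₃)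
    (key _ _ _ g₄ h₄)
  refine ⟨c, a, b, ?_⟩
  calc V = pauli a b * (pauli a b * V) := by rw [← mul_assoc, pauli_mul_self, one_mul]
    _ = _ := by rw [hc, mul_smul_comm, mul_one]

/-- Transposition fixes each Pauli matrix up to sign, so `U` and the inverse of `Uᵀ` act in the same
way on Pauli matrices up to scalars; hence `U Uᵀ` commutes with them up to scalars. -/
theorem clifford_mul_transpose {U : U4} (hU : U ∈ phasedClifford) :
    ∃ c : ℂ, ∃ a b, (U : TwoQubitMatrix ℂ) * (U : TwoQubitMatrix ℂ)ᵀ =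
      c • (pauli a b : TwoQubitMatrix ℂ) := by
  have hne : (U : TwoQubitMatrix ℂ) * (U : TwoQubitMatrix ℂ)ᵀ ≠ 0 := by
    intro h
    apply coe_ne_zero U
    have : (U : TwoQubitMatrix ℂ)ᵀ = 0 := by
      rw [← one_mul (U : TwoQubitMatrix ℂ)ᵀ, ← star_mul_coe U, mul_assoc, h, mul_zero]
    rw [← transpose_transpose (U : TwoQubitMatrix ℂ), this, transpose_zero]
  refine exists_eq_smul_pauli_of_comm hne fun p _ => ?_
  obtain ⟨c, hc, a, b, h⟩ := pauli_mul_clifford hU p.1 p.2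
  obtain ⟨s, hs, ht⟩ := transpose_pauli p.1 p.2
  obtain ⟨s', -, ht'⟩ := transpose_pauli a b
  have hT := congrArg Matrix.transpose h
  rw [transpose_mul, transpose_smul, transpose_mul, ht, ht', mul_smul_comm, smul_mul_assoc,
    smul_smul] at hT
  have hT' : (U : TwoQubitMatrix ℂ)ᵀ * pauli p.1 p.2 =
      (s⁻¹ * (c * s')) • ((pauli a b : TwoQubitMatrix ℂ) * (U : TwoQubitMatrix ℂ)ᵀ) := by
    rw [← smul_smul, ← hT, smul_smul, inv_mul_cancel₀ hs, one_smul]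
  have h' : (U : TwoQubitMatrix ℂ) * pauli a b =
      c⁻¹ • ((pauli p.1 p.2 : TwoQubitMatrix ℂ) * U) := by
    rw [h, smul_smul, inv_mul_cancel₀ hc, one_smul]
  refine ⟨s⁻¹ * (c * s') * c⁻¹, ?_⟩
  rw [Matrix.mul_assoc, hT', mul_smul_comm, ← Matrix.mul_assoc, h', smul_mul_assoc, smul_smul,
    Matrix.mul_assoc]

/-! ### The action on antisymmetric matrices -/

open SignedPerm

/-- The six antisymmetric two-qubit Pauli matrices, with phases such that `(A Bᴴ)² = -1` for
any two different ones. The order is such that the gates `P₁`, `H₁`, `H₂`, `P₂` act by the swaps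
`(0 1)`, `(1 2)`, `(3 4)`, `(4 5)`. -/
def gaussBasis : Fin 6 → TwoQubitMatrix GaussianInt :=
  ![gaussPauli 0 2, gaussI • gaussPauli 3 2, gaussI • gaussPauli 1 2, gaussPauli 2 1,
    gaussPauli 2 3, gaussI • gaussPauli 2 0]

theorem gaussBasis_mul_conjTranspose : ∀ a, gaussBasis a * (gaussBasis a)ᴴ = 1 := by
  decide +kernel

theorem gaussBasis_gram_sq : ∀ a b, a ≠ b → gaussBasis a * (gaussBasis b)ᴴ *
    (gaussBasis a * (gaussBasis b)ᴴ) = -1 := by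
  decide +kernel

theorem gaussBasis_trace : ∀ a b, a ≠ b → (gaussBasis a * (gaussBasis b)ᴴ).trace = 0 := by
  decide +kernel

theorem gaussBasis_transpose : ∀ a, (gaussBasis a)ᵀ = -gaussBasis a := by
  decide +kernel

theorem exists_gaussBasis_eq : ∀ k, ∃ c ∈ phaseUnits, ∃ a b,
    gaussBasis k = c • gaussPauli a b := by
  decide +kernel

theorem exists_gaussPauli_eq : ∀ a b, (gaussPauli a b)ᵀ = -gaussPauli a b →
    ∃ c ∈ phaseUnits, ∃ k, gaussPauli a b = c • gaussBasis k := by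
  decide +kernel

theorem exists_gaussPauli_eq_gram : ∀ p ∈ [((1 : Fin 4), (0 : Fin 4)), (3, 0), (0, 1), (0, 3)],
    ∃ c ∈ phaseUnits, ∃ a b, gaussPauli p.1 p.2 = c • (gaussBasis a * (gaussBasis b)ᴴ) := by
  decide +kernel

/-- The six antisymmetric Pauli matrices as complex matrices, a basis of the antisymmetric
matrices. -/
def asymBasis (a : Fin 6) : TwoQubitMatrix ℂ := toC (gaussBasis a)

theorem asymBasis_mul_conjTranspose (a : Fin 6) : asymBasis a * (asymBasis a)ᴴ = 1 := by
  rw [asymBasis, ← toC_conjTranspose, ← map_mul, gaussBasis_mul_conjTranspose, map_one]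

theorem asymBasis_ne_zero (a : Fin 6) : asymBasis a ≠ 0 := fun h => by
  have := asymBasis_mul_conjTranspose a
  rw [h, zero_mul] at this
  exact zero_ne_one this

theorem asymBasis_gram_sq {a b : Fin 6} (h : a ≠ b) : asymBasis a * (asymBasis b)ᴴ *
    (asymBasis a * (asymBasis b)ᴴ) = -1 := by
  rw [asymBasis, asymBasis, ← toC_conjTranspose, ← map_mul, ← map_mul, gaussBasis_gram_sq a b h,
    map_neg, map_one]

theorem asymBasis_trace {a b : Fin 6} (h : a ≠ b) : (asymBasis a * (asymBasis b)ᴴ).trace = 0 := by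
  rw [asymBasis, asymBasis, ← toC_conjTranspose, ← map_mul, trace_toC, gaussBasis_trace a b h,
    map_zero]

theorem eq_of_asymBasis_eq_smul {a b : Fin 6} {c : ℂ} (h : asymBasis a = c • asymBasis b) :
    a = b := by
  by_contra hab
  have h1 := asymBasis_trace hab
  have hc : c ≠ 0 := by
    rintro rfl
    exact asymBasis_ne_zero a (by rw [h, zero_smul])
  rw [h, smul_mul_assoc, asymBasis_mul_conjTranspose, trace_smul, trace_one] at h1
  simp [hc] at h1

theorem transpose_mul_conjTranspose (U : U4) :
    (U : TwoQubitMatrix ℂ)ᵀ * (U : TwoQubitMatrix ℂ)ᵀᴴ = 1 := by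
  have h : (U : TwoQubitMatrix ℂ)ᴴ * (U : TwoQubitMatrix ℂ) = 1 := star_mul_coe U
  have h' := congrArg Matrix.transpose h
  rwa [transpose_mul, transpose_one] at h'

/-- The action `A ↦ U A Uᵀ` on antisymmetric matrices determines conjugation by `U` on their
products `A Bᴴ`, because `Uᵀ` is unitary. -/
theorem conj_gram (U : U4) {A B X Y : TwoQubitMatrix ℂ} {c d : ℂ}
    (hA : (U : TwoQubitMatrix ℂ) * A * (U : TwoQubitMatrix ℂ)ᵀ = c • X)
    (hB : (U : TwoQubitMatrix ℂ) * B * (U : TwoQubitMatrix ℂ)ᵀ = d • Y) :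
    (U : TwoQubitMatrix ℂ) * (A * Bᴴ) * (U : TwoQubitMatrix ℂ)ᴴ = (c * star d) • (X * Yᴴ) := by
  rw [← smul_mul_smul_comm, ← conjTranspose_smul, ← hA, ← hB]
  rw [conjTranspose_mul, conjTranspose_mul]
  simp only [Matrix.mul_assoc]
  rw [← Matrix.mul_assoc _ (U : TwoQubitMatrix ℂ)ᵀᴴ, transpose_mul_conjTranspose, Matrix.one_mul]

/-- The map `A ↦ U A Uᵀ` acts on the six antisymmetric Pauli matrices by the signed permutation `g`,
up to one common scalar. As the scalar is free, `g` matters only up to `±1`. -/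
def Acts (U : TwoQubitMatrix ℂ) (g : SignedPerm) : Prop :=
  ∃ c : ℂ, c ≠ 0 ∧ ∀ a, U * asymBasis a * Uᵀ =
    (c * ((g.left (g.right a) : ℤ) : ℂ)) • asymBasis (g.right a)

theorem intUnits_cast_mul_self (u : ℤˣ) : ((u : ℤ) : ℂ) * ((u : ℤ) : ℂ) = 1 := by
  rw [← Int.cast_mul, ← Units.val_mul, Int.units_mul_self]; simp

theorem intUnits_cast_ne_zero (u : ℤˣ) : ((u : ℤ) : ℂ) ≠ 0 :=
  left_ne_zero_of_mul_eq_one (intUnits_cast_mul_self u)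

namespace Acts

variable {U V : TwoQubitMatrix ℂ} {g h : SignedPerm}

theorem one : Acts 1 1 := ⟨1, one_ne_zero, fun a => by simp⟩

theorem mul (hU : Acts U g) (hV : Acts V h) : Acts (U * V) (g * h) := by
  obtain ⟨c, hc, hU⟩ := hU
  obtain ⟨d, hd, hV⟩ := hV
  refine ⟨c * d, mul_ne_zero hc hd, fun a => ?_⟩
  have e : (g * h).left ((g * h).right a) = g.left (g.right (h.right a)) * h.left (h.right a) := by
    rw [mul_left_apply]
    simp
  calc U * V * asymBasis a * (U * V)ᵀ = U * (V * asymBasis a * Vᵀ) * Uᵀ := by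
        rw [transpose_mul]; simp only [Matrix.mul_assoc]
    _ = _ := by
        rw [hV, mul_smul_comm, smul_mul_assoc, hU, smul_smul, e]
        push_cast
        congr 1
        ring

theorem negOne_mul (hU : Acts U g) : Acts U (negOne * g) := by
  obtain ⟨c, hc, hU⟩ := hU
  refine ⟨-c, neg_ne_zero.2 hc, fun a => ?_⟩
  rw [hU, negOne_mul_right, negOne_mul_left]
  push_cast
  rw [neg_mul_neg]

theorem smul {z : ℂ} (hz : z ≠ 0) (hU : Acts U g) : Acts (z • U) g := by
  obtain ⟨c, hc, hU⟩ := hU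
  refine ⟨z * z * c, mul_ne_zero (mul_ne_zero hz hz) hc, fun a => ?_⟩
  rw [transpose_smul, smul_mul_assoc, mul_smul_comm, smul_mul_assoc, hU, smul_smul, smul_smul]
  congr 1
  ring

theorem inv {U : U4} (hU : Acts U g) : Acts ((U⁻¹ : U4) : TwoQubitMatrix ℂ) g⁻¹ := by
  obtain ⟨c, hc, hU⟩ := hU
  refine ⟨c⁻¹, inv_ne_zero hc, fun a => ?_⟩
  obtain ⟨b, rfl⟩ := g.right.surjective a
  have hb : g⁻¹.right (g.right b) = b := by simp
  have h1 : (U⁻¹ : U4) * (U : TwoQubitMatrix ℂ) = 1 := star_mul_coe U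
  have h2 := congrArg Matrix.transpose h1
  rw [transpose_mul, transpose_one] at h2
  have key : asymBasis b = (c * ((g.left (g.right b) : ℤ) : ℂ)) •
      ((U⁻¹ : U4) * asymBasis (g.right b) * ((U⁻¹ : U4) : TwoQubitMatrix ℂ)ᵀ) := by
    rw [← smul_mul_assoc, ← mul_smul_comm, ← hU]
    simp only [Matrix.mul_assoc]
    rw [h2, Matrix.mul_one, ← Matrix.mul_assoc, h1, Matrix.one_mul]
  rw [hb, inv_left_apply, Int.units_inv_eq_self]
  rw [key, smul_smul, mul_mul_mul_comm, inv_mul_cancel₀ hc, intUnits_cast_mul_self, one_mul,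
    one_smul]

theorem of_gauss (M : TwoQubitMatrix GaussianInt) (c : GaussianInt) (hc : c ≠ 0)
    (h : ∀ a, M * gaussBasis a * Mᵀ =
      (c * ((g.left (g.right a) : ℤ) : GaussianInt)) • gaussBasis (g.right a)) :
    Acts (toC M) g := by
  refine ⟨GaussianInt.toComplex c, GaussianInt.toComplex_eq_zero.not.2 hc, fun a => ?_⟩
  rw [asymBasis, ← toC_transpose, ← map_mul, ← map_mul, h, toC_smul, map_mul, map_intCast]
  rfl

/-- The scalars by which a unitary matrix permutes the antisymmetric Pauli matrices have modulus
one. -/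
theorem mul_star_self {U : U4} {c : ℂ} {a b : Fin 6}
    (h : (U : TwoQubitMatrix ℂ) * asymBasis a * (U : TwoQubitMatrix ℂ)ᵀ = c • asymBasis b) :
    c * star c = 1 := by
  have := conj_gram U h h
  rw [asymBasis_mul_conjTranspose, asymBasis_mul_conjTranspose, Matrix.mul_one] at this
  have h1 : (U : TwoQubitMatrix ℂ) * (U : TwoQubitMatrix ℂ)ᴴ = 1 := coe_mul_star U
  rw [h1] at this
  have := congrFun (congrFun this 0) 0
  simpa using this.symm

theorem gram {U : U4} (hU : Acts U g) (a b : Fin 6) :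
    (U : TwoQubitMatrix ℂ) * (asymBasis a * (asymBasis b)ᴴ) * (U : TwoQubitMatrix ℂ)ᴴ =
      (((g.left (g.right a) * g.left (g.right b) : ℤˣ) : ℤ) : ℂ) •
        (asymBasis (g.right a) * (asymBasis (g.right b))ᴴ) := by
  obtain ⟨c, hc, hU⟩ := hU
  rw [conj_gram U (hU a) (hU b)]
  have h1 := mul_star_self (hU b)
  congr 1
  have h2 : star (((g.left (g.right b) : ℤˣ) : ℤ) : ℂ) = ((g.left (g.right b) : ℤ) : ℂ) :=
    star_intCast _
  rw [star_mul', h2] at h1 ⊢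
  have h3 := intUnits_cast_mul_self (g.left (g.right b))
  have h4 : c * star c = 1 := by
    calc c * star c = c * star c * (((g.left (g.right b) : ℤ) : ℂ) * ((g.left (g.right b) : ℤ) : ℂ))
          := by rw [h3, mul_one]
      _ = 1 := by rw [← h1]; ring
  push_cast
  calc _ = c * star c * (((g.left (g.right a) : ℤ) : ℂ) * ((g.left (g.right b) : ℤ) : ℂ)) := by ring
    _ = _ := by rw [h4, one_mul]

/-- The signed permutation by which a matrix acts is unique up to `±1`. -/
theorem eq_or_eq (hU : Acts U g) (hU' : Acts U h) : g = h ∨ g = negOne * h := by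
  obtain ⟨c, hc, hU⟩ := hU
  obtain ⟨d, hd, hV⟩ := hU'
  have hr : ∀ a, g.right a = h.right a := fun a => by
    have hne := mul_ne_zero hc (intUnits_cast_ne_zero (g.left (g.right a)))
    refine eq_of_asymBasis_eq_smul (c := (c * ((g.left (g.right a) : ℤ) : ℂ))⁻¹ *
      (d * ((h.left (h.right a) : ℤ) : ℂ))) ?_
    rw [← smul_smul, ← hV, hU, smul_smul, inv_mul_cancel₀ hne, one_smul]
  have hr' : g.right = h.right := Equiv.ext hr
  have hl : ∀ a, c * ((g.left a : ℤ) : ℂ) = d * ((h.left a : ℤ) : ℂ) := fun a => by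
    obtain ⟨b, rfl⟩ := g.right.surjective a
    refine smul_left_injective ℂ (asymBasis_ne_zero (g.right b)) ?_
    have := (hU b).symm.trans (hV b)
    rwa [← hr b] at this
  have hcd : ∀ a, c = d * (((h.left a * g.left a : ℤˣ) : ℤ) : ℂ) := fun a => by
    push_cast
    rw [← mul_assoc, ← hl, mul_assoc, intUnits_cast_mul_self, mul_one]
  have hconst : ∀ a, h.left a * g.left a = h.left 0 * g.left 0 := fun a => by
    have := mul_left_cancel₀ hd ((hcd a).symm.trans (hcd 0))
    exact Units.ext (Int.cast_injective this)
  have hg : ∀ a, g.left a = h.left 0 * g.left 0 * h.left a := fun a => by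
    rw [← hconst a, mul_right_comm, Int.units_mul_self, one_mul]
  rcases Int.units_eq_one_or (h.left 0 * g.left 0) with h0 | h0
  · left
    refine SemidirectProduct.ext (funext fun a => ?_) hr'
    rw [hg a, h0, one_mul]
  · right
    refine SemidirectProduct.ext (funext fun a => ?_) ?_
    · rw [hg a, h0, negOne_mul_left, neg_one_mul]
    · rw [negOne_mul_right, hr']

/-- If no line is moved, then the products `A Bᴴ` are fixed up to sign under conjugation; these
include multiples of `X ⊗ I`, `Z ⊗ I`, `I ⊗ X`, `I ⊗ Z`. -/
theorem comm_of_diagonal {U : U4} (hU : Acts U g) (hg : g.right = 1) :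
    ∀ p ∈ [((1 : Fin 4), (0 : Fin 4)), (3, 0), (0, 1), (0, 3)], ∃ a b,
      (U : TwoQubitMatrix ℂ) * pauli p.1 p.2 =
        (((g.left a * g.left b : ℤˣ) : ℤ) : ℂ) • ((pauli p.1 p.2 : TwoQubitMatrix ℂ) * U) := by
  intro p hp
  obtain ⟨k, -, a, b, h⟩ := exists_gaussPauli_eq_gram p hp
  refine ⟨a, b, ?_⟩
  have hG := hU.gram a b
  simp only [hg, Perm.one_apply] at hG
  have hG' := congrArg (· * (U : TwoQubitMatrix ℂ)) hG
  have h1 : (U : TwoQubitMatrix ℂ)ᴴ * (U : TwoQubitMatrix ℂ) = 1 := star_mul_coe U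
  simp only [Matrix.mul_assoc _ _ (U : TwoQubitMatrix ℂ), h1, Matrix.mul_one] at hG'
  have hp : (pauli p.1 p.2 : TwoQubitMatrix ℂ) =
      GaussianInt.toComplex k • (asymBasis a * (asymBasis b)ᴴ) := by
    rw [coe_pauli, h, toC_smul, map_mul, toC_conjTranspose]; rfl
  rw [hp, mul_smul_comm, smul_mul_assoc, smul_comm, hG', smul_mul_assoc]

theorem exists_eq_smul_one_of_one {U : U4} (hU : Acts U 1) :
    ∃ c : ℂ, (U : TwoQubitMatrix ℂ) = c • 1 := by
  have h : ∀ p ∈ [((1 : Fin 4), (0 : Fin 4)), (3, 0), (0, 1), (0, 3)],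
      (U : TwoQubitMatrix ℂ) * pauli p.1 p.2 = (pauli p.1 p.2 : TwoQubitMatrix ℂ) * U := by
    intro p hp
    obtain ⟨a, b, h⟩ := hU.comm_of_diagonal rfl p hp
    simpa using h
  exact exists_eq_smul_one (h (1, 0) (by decide)) (h (3, 0) (by decide)) (h (0, 1) (by decide))
    (h (0, 3) (by decide))

theorem exists_eq_smul_pauli {U : U4} (hU : Acts U g) (hg : g.right = 1) :
    ∃ c : ℂ, ∃ a b, (U : TwoQubitMatrix ℂ) = c • (pauli a b : TwoQubitMatrix ℂ) :=
  exists_eq_smul_pauli_of_comm (coe_ne_zero U) fun p hp => by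
    obtain ⟨a, b, h⟩ := hU.comm_of_diagonal hg p hp
    exact ⟨_, h⟩

theorem toClifford_eq {U V : phasedClifford} (hU : Acts (U : U4) g) (hV : Acts (V : U4) g) :
    toClifford U = toClifford V := by
  have h : Acts ((V.1⁻¹ * U.1 : U4) : TwoQubitMatrix ℂ) 1 := by
    rw [← inv_mul_cancel g]
    exact hV.inv.mul hU
  exact (QuotientGroup.eq.2 h.exists_eq_smul_one_of_one).symm

/-- A Clifford matrix acts by a signed permutation. It sends an antisymmetric Pauli matrix `A` to
`(U A U⁻¹) (U Uᵀ)`, which is a multiple of a Pauli matrix and again antisymmetric. The ratios of the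
scalars are signs because the products `A Bᴴ` and their images all have square `-1`. -/
theorem exists_of_clifford {U : U4} (hU : U ∈ phasedClifford) : ∃ g, Acts U g := by
  have h1 : ∀ k, ∃ l, ∃ d : ℂ, (U : TwoQubitMatrix ℂ) * asymBasis k * (U : TwoQubitMatrix ℂ)ᵀ =
      d • asymBasis l := by
    intro k
    obtain ⟨c, -, a, b, hk⟩ := exists_gaussBasis_eq k
    have hk' : asymBasis k = GaussianInt.toComplex c • (pauli a b : TwoQubitMatrix ℂ) := by
      rw [asymBasis, hk, toC_smul, coe_pauli]
    obtain ⟨c', -, a', b', h'⟩ := clifford_mul_pauli hU a b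
    obtain ⟨c₀, a₀, b₀, h₀⟩ := clifford_mul_transpose hU
    obtain ⟨c₁, -, x, y, h₂⟩ := pauli_mul_pauli a' b' a₀ b₀
    have hP : ∃ z : ℂ, (U : TwoQubitMatrix ℂ) * asymBasis k * (U : TwoQubitMatrix ℂ)ᵀ =
        z • (pauli x y : TwoQubitMatrix ℂ) := by
      refine ⟨GaussianInt.toComplex c * (c' * (c₀ * c₁)), ?_⟩
      rw [hk', mul_smul_comm, h', smul_mul_assoc, smul_mul_assoc, Matrix.mul_assoc, h₀,
        mul_smul_comm, h₂, smul_smul, smul_smul, smul_smul]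
      simp only [mul_assoc]
    obtain ⟨z, hz⟩ := hP
    have hT := congrArg Matrix.transpose hz
    have hA : (asymBasis k)ᵀ = -asymBasis k := by
      rw [asymBasis, ← toC_transpose, gaussBasis_transpose, map_neg]
    rw [transpose_mul, transpose_mul, transpose_transpose, hA, ← Matrix.mul_assoc, Matrix.mul_neg,
      Matrix.neg_mul, hz, transpose_smul] at hT
    -- The scalar is never zero, but in that case the claim needs no argument.
    by_cases hz0 : z = 0
    · exact ⟨0, 0, by rw [hz, hz0, zero_smul, zero_smul]⟩
    have hT' : (pauli x y : TwoQubitMatrix ℂ)ᵀ = -(pauli x y : TwoQubitMatrix ℂ) := by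
      rw [← smul_neg] at hT
      exact (smul_right_injective _ hz0 hT).symm
    rw [coe_pauli, ← toC_transpose, ← map_neg] at hT'
    obtain ⟨e, -, l, hl⟩ := exists_gaussPauli_eq x y (toC_injective hT')
    exact ⟨l, z * GaussianInt.toComplex e, by rw [hz, coe_pauli, hl, toC_smul, smul_smul]; rfl⟩
  choose f d hfd using h1
  have hd : ∀ a, d a * star (d a) = 1 := fun a => mul_star_self (hfd a)
  have hUU : (U : TwoQubitMatrix ℂ)ᴴ * (U : TwoQubitMatrix ℂ) = 1 := star_mul_coe U
  have hUU' : (U : TwoQubitMatrix ℂ) * (U : TwoQubitMatrix ℂ)ᴴ = 1 := coe_mul_star U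
  have hd0 : ∀ a, d a ≠ 0 := fun a => left_ne_zero_of_mul_eq_one (hd a)
  have hf : Function.Injective f := by
    intro a b hab
    by_contra hne
    have := congrArg Matrix.trace (conj_gram U (hfd a) (hfd b))
    rw [hab, asymBasis_mul_conjTranspose, Matrix.trace_mul_comm, ← Matrix.mul_assoc, hUU,
      Matrix.one_mul, asymBasis_trace hne, trace_smul, trace_one] at this
    simp [hd0] at this
  have hsign : ∀ a, ∃ u : ℤˣ, d a = d 0 * ((u : ℤ) : ℂ) := by
    intro a
    by_cases ha : a = 0
    · exact ⟨1, by simp [ha]⟩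
    have hG := conj_gram U (hfd a) (hfd 0)
    have hsq := congrArg₂ (· * ·) hG hG
    rw [smul_mul_smul_comm, asymBasis_gram_sq (hf.ne ha)] at hsq
    have hsq' : (-1 : TwoQubitMatrix ℂ) = (d a * star (d 0) * (d a * star (d 0))) • -1 := by
      rw [← hsq]
      symm
      calc _ = (U : TwoQubitMatrix ℂ) * (asymBasis a * (asymBasis 0)ᴴ *
            (((U : TwoQubitMatrix ℂ)ᴴ * U) * (asymBasis a * (asymBasis 0)ᴴ))) *
              (U : TwoQubitMatrix ℂ)ᴴ := by simp only [Matrix.mul_assoc]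
        _ = -1 := by
          rw [hUU, Matrix.one_mul, asymBasis_gram_sq ha, Matrix.mul_neg, Matrix.mul_one,
            Matrix.neg_mul, hUU']
    have hone := congrFun (congrFun hsq' 0) 0
    have hone' : d a * star (d 0) * (d a * star (d 0)) = 1 := by simpa using hone.symm
    have hda : d a = d 0 * (d a * star (d 0)) := by
      rw [mul_left_comm, hd 0, mul_one]
    rcases mul_self_eq_one_iff.1 hone' with h | h
    · exact ⟨1, by rw [hda, h]; simp⟩
    · exact ⟨-1, by rw [hda, h]; simp⟩
  choose u hu using hsign
  let π : Perm (Fin 6) := Equiv.ofBijective f (Finite.injective_iff_bijective.1 hf)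
  refine ⟨⟨fun a => u (π.symm a), π⟩, d 0, hd0 0, fun a => ?_⟩
  rw [hfd a, hu a]
  simp only [Equiv.symm_apply_apply]
  rfl

end Acts

/-! ### The action of the Pauli matrices and of the gates -/

namespace Acts

/-- Pauli matrices act by diagonal signs of product one. -/
theorem exists_pauli (a b : Fin 4) : ∃ ε : Fin 6 → ℤˣ,
    det ⟨ε, 1⟩ = 1 ∧ Acts (pauli a b : U4) ⟨ε, 1⟩ := by
  have h : ∀ a b, ∃ ε : Fin 6 → ℤˣ, ∏ k, ε k = 1 ∧ ∀ k,
      gaussPauli a b * gaussBasis k * (gaussPauli a b)ᵀ =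
        (1 * ((ε k : ℤ) : GaussianInt)) • gaussBasis k := by
    decide +kernel
  obtain ⟨ε, hε, h⟩ := h a b
  refine ⟨ε, by rw [det_apply]; simpa using hε, ?_⟩
  rw [coe_pauli]
  exact of_gauss _ 1 one_ne_zero h

/-- All diagonal signs of product one come from Pauli matrices. -/
theorem exists_pauli_of_det {ε : Fin 6 → ℤˣ} (hε : det ⟨ε, 1⟩ = 1) :
    ∃ a b, Acts (pauli a b : U4) ⟨ε, 1⟩ := by
  have h : ∀ ε : Fin 6 → ℤˣ, ∏ k, ε k = 1 → ∃ a b, ∃ u : ℤˣ, ∀ k,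
      gaussPauli a b * gaussBasis k * (gaussPauli a b)ᵀ =
        (((u : ℤ) : GaussianInt) * ((ε k : ℤ) : GaussianInt)) • gaussBasis k := by
    decide +kernel
  rw [det_apply] at hε
  obtain ⟨a, b, u, h⟩ := h ε (by simpa using hε)
  refine ⟨a, b, ?_⟩
  rw [coe_pauli]
  exact of_gauss _ _ (Int.cast_ne_zero.2 u.ne_zero) h

end Acts

/-- The signed permutation by which `H ⊗ I` acts. -/
def hadamardOneAction : SignedPerm := ⟨![1, 1, 1, -1, -1, -1], swap 1 2⟩

/-- The signed permutation by which `I ⊗ H` acts. -/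
def hadamardTwoAction : SignedPerm := ⟨![-1, -1, -1, 1, 1, 1], swap 3 4⟩

/-- The signed permutation by which `P ⊗ I` acts. -/
def phaseOneAction : SignedPerm := ⟨![1, -1, 1, 1, 1, 1], swap 0 1⟩

/-- The signed permutation by which `I ⊗ P` acts. -/
def phaseTwoAction : SignedPerm := ⟨![1, 1, 1, 1, 1, -1], swap 4 5⟩

/-- The signed permutation by which the controlled-`Z` gate acts. -/
def controlledZAction : SignedPerm := ⟨![1, -1, 1, -1, 1, -1], swap 0 1 * swap 2 3 * swap 4 5⟩

theorem coe_hadamard : (hadamard : Matrix (Fin 2) (Fin 2) ℂ) = ((√2 : ℝ) : ℂ)⁻¹ •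
    (!![1, 1; 1, -1] : Matrix (Fin 2) (Fin 2) GaussianInt).map GaussianInt.toComplex := by
  ext i j; fin_cases i <;> fin_cases j <;> simp [hadamard]

theorem coe_phase : (phase : Matrix (Fin 2) (Fin 2) ℂ) =
    (!![1, 0; 0, gaussI] : Matrix (Fin 2) (Fin 2) GaussianInt).map GaussianInt.toComplex := by
  ext i j; fin_cases i <;> fin_cases j <;> simp [phase, toComplex_gaussI]

theorem coe_one : ((1 : U2) : Matrix (Fin 2) (Fin 2) ℂ) =
    (1 : Matrix (Fin 2) (Fin 2) GaussianInt).map GaussianInt.toComplex :=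
  (map_one GaussianInt.toComplex.mapMatrix).symm

theorem coe_tensor (A B : U2) : (tensor A B : TwoQubitMatrix ℂ) =
    (A : Matrix (Fin 2) (Fin 2) ℂ) ⊗ₖ (B : Matrix (Fin 2) (Fin 2) ℂ) := rfl

theorem sqrt_two_inv_ne_zero : ((√2 : ℝ) : ℂ)⁻¹ ≠ 0 := by simp

theorem acts_hadamardOne : Acts (tensor hadamard 1 : U4) hadamardOneAction := by
  rw [coe_tensor, coe_hadamard, coe_one, smul_kronecker, ← toC_kronecker]
  exact (Acts.of_gauss _ 2 (by decide) (by decide +kernel)).smul sqrt_two_inv_ne_zero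

theorem acts_hadamardTwo : Acts (tensor 1 hadamard : U4) hadamardTwoAction := by
  rw [coe_tensor, coe_hadamard, coe_one, kronecker_smul, ← toC_kronecker]
  exact (Acts.of_gauss _ 2 (by decide) (by decide +kernel)).smul sqrt_two_inv_ne_zero

theorem acts_phaseOne : Acts (tensor phase 1 : U4) phaseOneAction := by
  rw [coe_tensor, coe_phase, coe_one, ← toC_kronecker]
  exact Acts.of_gauss _ gaussI (by decide) (by decide +kernel)

theorem acts_phaseTwo : Acts (tensor 1 phase : U4) phaseTwoAction := by
  rw [coe_tensor, coe_phase, coe_one, ← toC_kronecker]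
  exact Acts.of_gauss _ gaussI (by decide) (by decide +kernel)

theorem acts_controlledZ : Acts (controlledZ : U4) controlledZAction := by
  have h : (controlledZ : TwoQubitMatrix ℂ) = toC
      (!![1, 0; 0, 0] ⊗ₖ (1 : Matrix (Fin 2) (Fin 2) GaussianInt) +
        !![0, 0; 0, 1] ⊗ₖ !![1, 0; 0, -1]) := by
    ext ⟨i, i'⟩ ⟨j, j'⟩
    fin_cases i <;> fin_cases i' <;> fin_cases j <;> fin_cases j' <;>
      simp [controlledZ, toC_apply]
  rw [h]
  exact Acts.of_gauss _ gaussI (by decide) (by decide +kernel)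

theorem hadamardOne_mem : tensor hadamard 1 ∈ phasedClifford :=
  tensor_mem_phasedClifford 1 (by rw [pow_succ, pow_one, hadamard_sq]) (one_pow _)
    (fun _ => hadamard_conj) (fun _ => one_conj)

theorem hadamardTwo_mem : tensor 1 hadamard ∈ phasedClifford :=
  tensor_mem_phasedClifford 1 (one_pow _) (by rw [pow_succ, pow_one, hadamard_sq])
    (fun _ => one_conj) (fun _ => hadamard_conj)

theorem phaseOne_mem : tensor phase 1 ∈ phasedClifford :=
  tensor_mem_phasedClifford 3 phase_pow (one_pow _) (fun _ => phase_conj) (fun _ => one_conj)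

theorem phaseTwo_mem : tensor 1 phase ∈ phasedClifford :=
  tensor_mem_phasedClifford 3 (one_pow _) phase_pow (fun _ => one_conj) (fun _ => phase_conj)

theorem phasedPauli_le : phasedPauli ≤ phasedClifford := Subgroup.le_normalizer

/-! ### The covering homomorphism -/

/-- The signed permutations of determinant one by which Clifford matrices act. -/
def realized : Submonoid SignedPerm where
  carrier := {g | det g = 1 ∧ ∃ U ∈ phasedClifford, Acts (U : U4) g}
  one_mem' := ⟨map_one _, 1, one_mem _, Acts.one⟩
  mul_mem' := by
    rintro g h ⟨hg, U, hU, hUg⟩ ⟨hh, V, hV, hVh⟩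
    exact ⟨by rw [map_mul, hg, hh, one_mul], U * V, mul_mem hU hV, hUg.mul hVh⟩

/-- The gates produce all adjacent swaps, hence all permutations; `(2 3)` comes from `CZ P₁ P₂`. -/
theorem exists_realized (π : Perm (Fin 6)) : ∃ g ∈ realized, g.right = π := by
  have h : realized.map SemidirectProduct.rightHom = ⊤ := by
    rw [eq_top_iff, ← Perm.mclosure_swap_castSucc_succ 5, Submonoid.closure_le]
    have m₁ : hadamardOneAction ∈ realized := ⟨by decide, _, hadamardOne_mem, acts_hadamardOne⟩
    have m₂ : hadamardTwoAction ∈ realized := ⟨by decide, _, hadamardTwo_mem, acts_hadamardTwo⟩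
    have m₃ : phaseOneAction ∈ realized := ⟨by decide, _, phaseOne_mem, acts_phaseOne⟩
    have m₄ : phaseTwoAction ∈ realized := ⟨by decide, _, phaseTwo_mem, acts_phaseTwo⟩
    have m₅ : controlledZAction ∈ realized := ⟨by decide, _, controlledZ_mem, acts_controlledZ⟩
    rintro _ ⟨i, rfl⟩
    fin_cases i
    · exact ⟨_, m₃, rfl⟩
    · exact ⟨_, m₁, rfl⟩
    · exact ⟨_, mul_mem (mul_mem m₅ m₃) m₄, by decide⟩
    · exact ⟨_, m₂, rfl⟩
    · exact ⟨_, m₄, rfl⟩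
  obtain ⟨g, hg, rfl⟩ : π ∈ realized.map SemidirectProduct.rightHom := h ▸ Submonoid.mem_top π
  exact ⟨g, hg, rfl⟩

/-- Signed permutations of determinant one with the same underlying permutation differ by diagonal
signs of product one, which Pauli matrices realize. -/
theorem mem_realized_of_det {g : SignedPerm} (hg : det g = 1) : g ∈ realized := by
  obtain ⟨r, hr, hgr⟩ := exists_realized g.right
  have hd : g * r⁻¹ ∈ realized := by
    have h1 : (g * r⁻¹).right = 1 := by simp [hgr]
    have h2 : det (g * r⁻¹) = 1 := by rw [map_mul, map_inv, hg, hr.1, inv_one, one_mul]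
    generalize g * r⁻¹ = x at h1 h2
    obtain ⟨ε, π⟩ := x
    obtain rfl : π = 1 := h1
    obtain ⟨a, b, h⟩ := Acts.exists_pauli_of_det h2
    exact ⟨h2, _, phasedPauli_le (pauli_mem a b), h⟩
  have := mul_mem hd hr
  rwa [inv_mul_cancel_right] at this

namespace Acts

/-- The determinant is one for every unitary matrix that acts by a signed permutation. A product of
gates corrects the permutation, and what remains is a multiple of a Pauli matrix. -/
theorem det_eq_one {U : U4} {g : SignedPerm} (h : Acts U g) :
    det g = 1 := by
  obtain ⟨r, ⟨hr, V, hV, hVr⟩, hgr⟩ := exists_realized g.right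
  have h1 := h.mul hVr.inv
  have hright : (g * r⁻¹).right = 1 := by simp [hgr]
  obtain ⟨c, a, b, hc⟩ := Acts.exists_eq_smul_pauli (U := U * V⁻¹) h1 hright
  obtain ⟨ε, hε, hP⟩ := exists_pauli a b
  have hc0 := ne_zero_of_coe_eq_smul hc
  have h2 : Acts ((U * V⁻¹ : U4) : TwoQubitMatrix ℂ) ⟨ε, 1⟩ := hc ▸ hP.smul hc0
  have h3 : det (g * r⁻¹) = 1 := by
    rcases h1.eq_or_eq h2 with e | e
    · rw [e, hε]
    · rw [e, map_mul, det_negOne, hε, one_mul]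
  rwa [map_mul, map_inv, hr, inv_one, mul_one] at h3

end Acts

/-- A Clifford matrix that acts by a given signed permutation of determinant one. -/
def realizer (g : det.ker) : phasedClifford :=
  ⟨(mem_realized_of_det g.2).2.choose, (mem_realized_of_det g.2).2.choose_spec.1⟩

theorem acts_realizer (g : det.ker) : Acts (realizer g : U4) g :=
  (mem_realized_of_det g.2).2.choose_spec.2

/-- The homomorphism to the Clifford group that sends a signed permutation of determinant one to the
class of the Clifford matrices that act by it. -/
def cover : det.ker →* CliffordGroup where
  toFun g := toClifford (realizer g)
  map_one' := by
    rw [← map_one toClifford]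
    exact Acts.toClifford_eq (acts_realizer 1) Acts.one
  map_mul' g h := by
    rw [← map_mul toClifford]
    exact Acts.toClifford_eq (acts_realizer (g * h)) ((acts_realizer g).mul (acts_realizer h))

theorem cover_eq {U : phasedClifford} {g : det.ker} (h : Acts (U : U4) g) :
    cover g = toClifford U :=
  Acts.toClifford_eq (acts_realizer g) h

theorem toClifford_eq_one_iff {U : phasedClifford} :
    toClifford U = 1 ↔ ∃ c : ℂ, ((U : U4) : TwoQubitMatrix ℂ) = c • 1 :=
  QuotientGroup.eq_one_iff U

theorem isCover_cover : IsCover cover where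
  surjective x := by
    obtain ⟨U, rfl⟩ := QuotientGroup.mk'_surjective _ x
    obtain ⟨g, hg⟩ := Acts.exists_of_clifford U.2
    exact ⟨⟨g, hg.det_eq_one⟩, cover_eq hg⟩
  eq_one_iff g := by
    constructor
    · intro h
      obtain ⟨c, hc⟩ := toClifford_eq_one_iff.1 h
      have hc0 := ne_zero_of_coe_eq_smul hc
      have h1 : Acts (realizer g : U4) 1 := hc ▸ Acts.one.smul hc0
      simpa using (acts_realizer g).eq_or_eq h1
    · intro h
      rw [← map_one toClifford]
      refine cover_eq (U := 1) ?_
      rcases h with h | h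
      · rw [h]; exact Acts.one
      · rw [h, ← mul_one negOne]; exact Acts.one.negOne_mul

theorem perm_toClifford {U : phasedClifford} {g : SignedPerm} (h : Acts (U : U4) g) :
    isCover_cover.perm (toClifford U) = g.right := by
  rw [← cover_eq (g := ⟨g, h.det_eq_one⟩) h, isCover_cover.perm_apply]

theorem pauliGroup_eq : pauliGroup = isCover_cover.perm.ker := by
  ext x
  constructor
  · rintro ⟨U, hU, rfl⟩
    obtain ⟨c, a, b, hc⟩ := exists_eq_smul_pauli (U := U) hU
    obtain ⟨ε, -, hP⟩ := Acts.exists_pauli a b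
    have hc0 := ne_zero_of_coe_eq_smul hc
    have h : Acts (U : U4) ⟨ε, 1⟩ := hc ▸ hP.smul hc0
    exact perm_toClifford h
  · intro hx
    obtain ⟨⟨⟨ε, π⟩, hg⟩, rfl⟩ := isCover_cover.surjective x
    rw [MonoidHom.mem_ker, isCover_cover.perm_apply] at hx
    obtain rfl : π = 1 := hx
    obtain ⟨a, b, h⟩ := Acts.exists_pauli_of_det hg
    let U : phasedClifford := ⟨pauli a b, phasedPauli_le (pauli_mem a b)⟩
    have hU : cover ⟨⟨ε, 1⟩, hg⟩ = toClifford U := cover_eq h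
    rw [hU]
    exact Subgroup.mem_map_of_mem toClifford (Subgroup.mem_subgroupOf.2 (pauli_mem a b))

theorem sgn_toClifford {U : phasedClifford} {g : SignedPerm} (h : Acts (U : U4) g)
    (hg : Perm.sign g.right = -1) : isCover_cover.sgn (toClifford U) = -1 := by
  rw [isCover_cover.sgn_apply, perm_toClifford h, hg]

end TwoQubit

end

theorem theorem5p1 :
    -- the order of the group
    Nat.card TwoQubit.CliffordGroup = 11520 ∧
    -- the proper nontrivial normal subgroups
    (∀ N : Subgroup TwoQubit.CliffordGroup,
      (N.Normal ∧ N ≠ ⊥ ∧ N ≠ ⊤) ↔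
        (N = TwoQubit.pauliGroup ∨ N = commutator TwoQubit.CliffordGroup)) ∧
    Nat.card TwoQubit.pauliGroup = 16 ∧
    Nat.card (commutator TwoQubit.CliffordGroup) = 5760 ∧
    -- conjugacy classes and irreducible characters
    Nat.card (ConjClasses TwoQubit.CliffordGroup) = 21 ∧
    (TwoQubit.irreducibleCharacters TwoQubit.CliffordGroup).ncard = 21 ∧
    -- linear characters and one-dimensional representations
    ∃ sgn : TwoQubit.CliffordGroup →* ℤˣ,
      sgn TwoQubit.H₁ = -1 ∧ sgn TwoQubit.H₂ = -1 ∧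
      sgn TwoQubit.P₁ = -1 ∧ sgn TwoQubit.P₂ = -1 ∧ sgn TwoQubit.CZ = -1 ∧
      (∀ χ : TwoQubit.CliffordGroup →* ℂˣ, χ = 1 ∨ χ = TwoQubit.signToLinear sgn) ∧
      (∀ (V : Type*) [AddCommGroup V] [Module ℂ V]
        (ρ : Representation ℂ TwoQubit.CliffordGroup V), Module.finrank ℂ V = 1 →
        (∀ g v, ρ g v = v) ∨ (∀ g v, ρ g v = ((sgn g : ℤ) : ℂ) • v)) := by
  have hΨ := TwoQubit.isCover_cover
  have := hΨ.finite
  refine ⟨hΨ.card_eq, ?_, ?_, ?_, hΨ.card_conjClasses, ?_, hΨ.sgn, ?_, ?_, ?_, ?_, ?_,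
    hΨ.linear_character_eq, ?_⟩
  · intro N
    rw [TwoQubit.pauliGroup_eq]
    exact hΨ.normal_iff N
  · rw [TwoQubit.pauliGroup_eq]
    exact hΨ.card_perm_ker
  · rw [hΨ.commutator_eq]
    exact hΨ.card_sgn_ker
  · rw [TwoQubit.ncard_irreducibleCharacters, hΨ.card_conjClasses]
  · exact TwoQubit.sgn_toClifford TwoQubit.acts_hadamardOne (by decide)
  · exact TwoQubit.sgn_toClifford TwoQubit.acts_hadamardTwo (by decide)
  · exact TwoQubit.sgn_toClifford TwoQubit.acts_phaseOne (by decide)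
  · exact TwoQubit.sgn_toClifford TwoQubit.acts_phaseTwo (by decide)
  · exact TwoQubit.sgn_toClifford TwoQubit.acts_controlledZ (by decide)
  · intro V _ _ ρ hV
    obtain ⟨χ, hχ⟩ := TwoQubit.representation_eq_smul ρ hV
    rcases hΨ.linear_character_eq χ with rfl | rfl
    · exact .inl fun g v => by rw [hχ, MonoidHom.one_apply, Units.val_one, one_smul]
    · exact .inr hχ
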